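/- Let $n\ge 0$. Write $\ln_k x=\sum_{m\ge1}x^m/m^k$ for the $k$th polylogarithm, and let $\Lambda(x)=(\Lambda_{jk}(x))_{0\le j,k\le n}$ be the multivalued matrix function on $\mathbb C\setminus\{0,1\}$ obtained by analytic continuation from the disk $|x-\tfrac12|<\tfrac12$ of $$\Lambda_{00}=1,\qquad \Lambda_{0k}=\ln_k x\ (k>0),\qquad \Lambda_{jk}=\frac{(2\pi i)^j}{(k-j)!}\log^{k-j}x\ (k\ge j>0),\qquad \Lambda_{jk}=0\ (k<j).$$ It satisfies $d\Lambda=\Lambda\omega$, where $\omega$ is the $(n+1)\times(n+1)$ matrix with superdiagonal $\frac{dz}{1-z},\frac{dz}{z},\dots,\frac{dz}{z}$ and zeros elsewhere. Let $e_0,\dots,e_n$ be the standard basis of $\mathbb C^{n+1}$ (row vectors). The $n$th polylogarithm variation of mixed Hodge structure $\mathbb V$ over $\mathbb C\setminus\{0,1\}$ has as fibre $V_x$ at $x$ the $\mathbb Q$-span in $\mathbb C^{n+1}$ of the values at $x$ of (all branches of) the rows of $\Lambda$. The canonical extension of its flat bundle to $\mathbb P^1$ is the trivial bundle with fibre $\mathbb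 C^{n+1}$ and connection $\nabla f=df-f\omega$, and its extended weight and Hodge bundles are the constant ones with fibres $$W_{-2l+1}=W_{-2l}=\operatorname{span}\{e_l,\dots,e_n\},\qquad F^{-p}=\operatorname{span}\{e_0,\dots,e_p\}.\qquad(*)$$ For a point $P\in\{0,1\}$ and a non-zero tangent vector $\vec v$ at $P$, the limit mixed Hodge structure associated with $\vec v$ is the mixed Hodge structure on the fibre $\mathbb C^{n+1}$ over $P$ whose Hodge and (complexified) weight filtrations are the fibres at $P$ of the extended bundles, and whose rational structure is obtained as follows. Choose a closed disk around $P$, otherwise contained in $\mathbb C\setminus\{0,1\}$, with a holomorphic parameter $t$ that identifies it with $|t|\le 1$, $t(P)=0$; choose a $\mathbb Q$-basis $v_0,\dots,v_n$ of the fibre of $\mathbb V$ over the point $t=1$ and extend it to multivalued flat sections $v_j(t)$. Let $T$ be the (unipotent) local monodromy operator, $N=\frac1{2\pi i}\log T$, and $s_j(t)=t^{-N}v_j(t)$, which is single valued and extends to $t=0$. If $\vec v=\lambda\,\partial/\partial t$, the rational structure is the $\mathbb Q$-span of $\lambda^N s_0(0),\dots,\lambda^N s_n(0)$. Then this construction can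 be carried out and does not depend on the choices for $\vec v=\partial/\partial z$ at $0$ and for $\vec v=-\partial/\partial z$ at $1$, it yields mixed Hodge structures, and: 1. The limit mixed Hodge structure at $\partial/\partial z$ at $0$ has as rational structure the $\mathbb Q$-span of $$e_0\quad\text{and}\quad (2\pi i)^k e_k\ (1\le k\le n).$$ 2. The limit mixed Hodge structure at $-\partial/\partial z$ at $1$ has as rational structure the $\mathbb Q$-span of $$e_0+\sum_{k=2}^n\zeta(k)e_k\quad\text{and}\quad (2\pi i)^k e_k\ (1\le k\le n),$$ where $\zeta$ is the Riemann zeta function. In both cases the Hodge and the complexified weight filtrations are those of $(*)$. -/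

import Mathlib

open Filter Topology Matrix
open scoped TensorProduct

noncomputable section

/-! ### Mixed Hodge structures -/

section Hodge

variable {V : Type*} [AddCommGroup V] [Module ℂ V] [Module ℚ V] [IsScalarTower ℚ ℂ V]

/-- Complex conjugation on `ℂ ⊗ Q`, namely `a ⊗ q ↦ conj a ⊗ q`. -/
def tensorConj (Q : Type*) [AddCommGroup Q] [Module ℚ Q] :
    (ℂ ⊗[ℚ] Q) →ₛₗ[starRingEnd ℂ] (ℂ ⊗[ℚ] Q) where
  toFun := LinearMap.rTensor Q (Complex.conjAe.toLinearMap.restrictScalars ℚ)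
  map_add' := map_add _
  map_smul' := by
    intro c x
    induction x using TensorProduct.induction_on with
    | zero => simp
    | tmul a q => simp [TensorProduct.smul_tmul']
    | add x y hx hy => simp only [smul_add, map_add, hx, hy]

/-- Complex conjugation on a complex vector space `V` with respect to a rational form `Q ⊆ V`
(meaning that the natural map `ℂ ⊗ Q → V` is an isomorphism). -/
def rationalConj (Q : Submodule ℚ V) (h : IsBaseChange ℂ Q.subtype) :
    V →ₛₗ[starRingEnd ℂ] V :=
  (h.equiv.toLinearMap.comp (tensorConj Q)).comp h.equiv.symm.toLinearMap

variable (V) in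
/-- A (rational) mixed Hodge structure with underlying complex vector space `V`: a rational form
`rat` of `V`, a finite increasing filtration `W` of the rational form, and a finite decreasing
filtration `F` of `V` which induces on each `Gr^W_w` a Hodge structure of weight `w`, i.e.
`Gr^W_w = F^p Gr^W_w ⊕ conj (F^q Gr^W_w)` whenever `p + q = w + 1`. -/
@[ext]
structure MixedHodgeStructure where
  rat : Submodule ℚ V
  finite_rat : Module.Finite ℚ rat
  isRationalForm : IsBaseChange ℂ rat.subtype
  W : ℤ → Submodule ℚ V
  W_le : ∀ w, W w ≤ rat
  W_mono : Monotone W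
  W_exhaustive : ∃ w, W w = rat
  W_separated : ∃ w, W w = ⊥
  F : ℤ → Submodule ℂ V
  F_anti : Antitone F
  F_exhaustive : ∃ p, F p = ⊤
  F_separated : ∃ p, F p = ⊥
  /-- `F^p Gr` and `conj (F^q Gr)` span `Gr^W_w` -/
  gr_span : ∀ w p q : ℤ, p + q = w + 1 →
    Submodule.span ℂ (W w : Set V) ≤
      (F p ⊓ Submodule.span ℂ (W w : Set V)) ⊔
      (F q ⊓ Submodule.span ℂ (W w : Set V)).map (rationalConj rat isRationalForm) ⊔
      Submodule.span ℂ (W (w - 1) : Set V)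
  /-- `F^p Gr` and `conj (F^q Gr)` meet in zero -/
  gr_disjoint : ∀ w p q : ℤ, p + q = w + 1 →
    ((F p ⊓ Submodule.span ℂ (W w : Set V)) ⊔ Submodule.span ℂ (W (w - 1) : Set V)) ⊓
      ((F q ⊓ Submodule.span ℂ (W w : Set V)).map (rationalConj rat isRationalForm) ⊔
        Submodule.span ℂ (W (w - 1) : Set V)) ≤
      Submodule.span ℂ (W (w - 1) : Set V)

end Hodge

/-! ### Variations over `ℂ - D` with trivial canonical extension, and their limits -/

section Limit

variable {ι : Type*} [Fintype ι] [DecidableEq ι]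

/-- The data of a variation of mixed Hodge structure on `X = ℂ - D` (`D` finite) whose canonical extension to the projective line is
the trivial bundle with fibre `ℂ^ι` (row vectors) and connection `∇ f = df - f ω`, where
`ω = conn z dz` has logarithmic poles with nilpotent residues along `D ∪ {∞}`, and whose extended
Hodge and weight bundles are constant. `fib x`, for `x ∈ X`, is the fibre at `x` of the local
system of `ℚ`-vector spaces. -/
structure LogVariation (ι : Type*) [Fintype ι] [DecidableEq ι] where
  D : Finset ℂ
  conn : ℂ → Matrix ι ι ℂ
  res : ℂ → Matrix ι ι ℂ
  conn_eq : ∀ z, z ∉ D → conn z = ∑ p ∈ D, (z - p)⁻¹ • res p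
  res_nilpotent : ∀ p ∈ D, IsNilpotent (res p)
  res_infty_nilpotent : IsNilpotent (-∑ p ∈ D, res p)
  fib : ℂ → Submodule ℚ (ι → ℂ)
  W : ℤ → Submodule ℂ (ι → ℂ)
  F : ℤ → Submodule ℂ (ι → ℂ)
  /-- Griffiths transversality -/
  griffiths : ∀ z, z ∉ D → ∀ p, ∀ v ∈ F p, v ᵥ* conn z ∈ F (p - 1)
  /-- the weight bundles are flat -/
  weight_flat : ∀ z, z ∉ D → ∀ w, ∀ v ∈ W w, v ᵥ* conn z ∈ W w
  /-- the relative weight condition, in the unipotent case -/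
  weight_res : ∀ p ∈ D, ∀ w, ∀ v ∈ W w, v ᵥ* res p ∈ W (w - 2)

/-- The logarithm `∑_{k ≥ 1} (-1)^(k-1) (T - 1)^k / k` of a unipotent matrix. All terms with
`k > card ι` vanish. -/
def unipotentLog (T : Matrix ι ι ℂ) : Matrix ι ι ℂ :=
  ∑ k ∈ Finset.range (Fintype.card ι), ((-1 : ℂ) ^ k / (k + 1)) • (T - 1) ^ (k + 1)

/-- The choices entering the construction of the limit mixed Hodge structure of `𝒱` at the point
`P`, for the non-zero tangent vector `v ∂/∂z`.

Multivalued functions on the punctured disk `0 < |t| ≤ 1` are functions of `u` with `t = exp u`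
and `re u ≤ 0`; continuing once around the origin counterclockwise is `u ↦ u + 2πi`, and the base
point `t = 1` is `u = 0`. -/
structure LimitChoice (𝒱 : LogVariation ι) (P v : ℂ) where
  /-- the embedded closed disk: `chart t` is the point with parameter `t` -/
  chart : ℂ → ℂ
  chart_analytic : AnalyticOnNhd ℂ chart (Metric.closedBall 0 1)
  chart_inj : Set.InjOn chart (Metric.closedBall 0 1)
  chart_zero : chart 0 = P
  chart_mem : ∀ t ∈ Metric.closedBall (0 : ℂ) 1, t ≠ 0 → chart t ∉ 𝒱.D
  /-- the logarithm of the `λ` with `v ∂/∂z = λ ∂/∂t` -/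
  logScale : ℂ
  scale_eq : Complex.exp logScale * deriv chart 0 = v
  /-- a rational basis of the fibre of the local system over the point `t = 1` -/
  basis : Module.Basis ι ℚ (𝒱.fib (chart 1))
  /-- the multivalued flat sections extending that basis -/
  sec : ι → ℂ → ι → ℂ
  sec_zero : ∀ j, sec j 0 = basis j
  sec_flat : ∀ j u, u.re ≤ 0 →
    HasDerivAt (sec j)
      ((deriv chart (Complex.exp u) * Complex.exp u) •
        (sec j u ᵥ* 𝒱.conn (chart (Complex.exp u)))) u
  /-- the local monodromy operator: `sec j` continues to `∑ k, T j k • sec k` -/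
  T : Matrix ι ι ℚ
  monodromy : ∀ j u, u.re ≤ 0 →
    sec j (u + 2 * Real.pi * Complex.I) = ∑ k, (T j k : ℂ) • sec k u
  unipotent : IsNilpotent (T - 1)
  /-- the values `s_j(0)` at the origin of the single valued sections `s_j(t) = t^{-N} v_j(t)`,
  where `N = log T / 2πi` -/
  s₀ : ι → ι → ℂ
  s_tendsto : ∀ j, Tendsto
    (fun u : ℂ => ∑ k, NormedSpace.exp
      (-u • ((2 * Real.pi * Complex.I : ℂ)⁻¹ • unipotentLog (T.map (Rat.cast : ℚ → ℂ)))) j k •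
        sec k u)
    (comap Complex.re atBot) (𝓝 (s₀ j))

namespace LimitChoice

variable {𝒱 : LogVariation ι} {P v : ℂ} (c : LimitChoice 𝒱 P v)

/-- The matrix, with respect to `v_1, …, v_m`, of the local monodromy logarithm
`N = log T / 2πi`. -/
def N : Matrix ι ι ℂ :=
  (2 * Real.pi * Complex.I : ℂ)⁻¹ • unipotentLog (c.T.map (Rat.cast : ℚ → ℂ))

/-- The `ℚ`-span of the `λ^N s_j(0)`. -/
def rationalForm : Submodule ℚ (ι → ℂ) :=
  Submodule.span ℚ (Set.range fun j =>
    ∑ k, NormedSpace.exp (c.logScale • c.N) j k • c.s₀ k)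

end LimitChoice

/-- `H` is the limit mixed Hodge structure of `𝒱` at `P ∈ D` associated with the tangent vector
`v ∂/∂z`: its rational form is the one constructed above (the construction is possible, and all
choices give the same result), and its Hodge and complexified weight filtrations are the fibres
at `P` of the extended bundles. -/
structure IsLimitMHS (𝒱 : LogVariation ι) (P v : ℂ) (H : MixedHodgeStructure (ι → ℂ)) : Prop where
  mem : P ∈ 𝒱.D
  ne_zero : v ≠ 0
  exists_choice : Nonempty (LimitChoice 𝒱 P v)
  rat_eq : ∀ c : LimitChoice 𝒱 P v, H.rat = c.rationalForm
  weight_eq : ∀ w, Submodule.span ℂ (H.W w : Set (ι → ℂ)) = 𝒱.W w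
  hodge_eq : ∀ p, H.F p = 𝒱.F p

end Limit

/-! ### The polylogarithm variation -/

section Polylog

/-- `c` is an analytic continuation along the path `γ` in `X` of the germ of `f` at the starting
point of `γ`: `c t` represents the germ at `γ t`. -/
structure IsContinuationAlong {E : Type*} [NormedAddCommGroup E] [NormedSpace ℂ E]
    (X : Set ℂ) (f : ℂ → E) {a b : ℂ} (γ : Path a b) (c : unitInterval → ℂ → E) : Prop where
  mem : ∀ t, γ t ∈ X
  start : c 0 =ᶠ[𝓝 a] f
  analytic : ∀ t, AnalyticAt ℂ (c t) (γ t)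
  compatible : ∀ t, ∀ᶠ s in 𝓝 t, c s =ᶠ[𝓝 (γ s)] c t

/-- The power series `∑_{m ≥ 1} x^m / m^k` of the `k`th polylogarithm, for `|x| < 1`. -/
def lnSeries (k : ℕ) (x : ℂ) : ℂ := ∑' m : ℕ, x ^ (m + 1) / ((m : ℂ) + 1) ^ k

/-- The principal branch, on the disk `|x - 1/2| < 1/2`, of the matrix of polylogarithms
(rows and columns are numbered `0, …, n`). -/
def polylogMatrix (n : ℕ) (x : ℂ) : Matrix (Fin (n + 1)) (Fin (n + 1)) ℂ :=
  Matrix.of fun j k =>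
    if (k : ℕ) < j then 0
    else if (j : ℕ) = 0 then (if (k : ℕ) = 0 then 1 else lnSeries k x)
    else (2 * Real.pi * Complex.I) ^ (j : ℕ) / (Nat.factorial (k - j : ℕ) : ℂ) *
      Complex.log x ^ (k - j : ℕ)

/-- The coefficient of `dz` in `ω`: on the superdiagonal `1/(1-z), 1/z, …, 1/z`, and `0`
elsewhere. -/
def polylogConn (n : ℕ) (z : ℂ) : Matrix (Fin (n + 1)) (Fin (n + 1)) ℂ :=
  Matrix.of fun j k =>
    if (k : ℕ) = j + 1 then (if (j : ℕ) = 0 then 1 / (1 - z) else 1 / z) else 0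

/-- The residues of `ω` at `0` and at `1`. -/
def polylogRes (n : ℕ) (p : ℂ) : Matrix (Fin (n + 1)) (Fin (n + 1)) ℂ :=
  Matrix.of fun j k =>
    if (k : ℕ) = j + 1 then
      (if (j : ℕ) = 0 then (if p = 1 then -1 else 0) else (if p = 0 then 1 else 0))
    else 0

/-- The fibre at `x` of the polylogarithm local system: the `ℚ`-span of the values at `x` of the
rows of the multivalued function `Λ`, i.e. of all the analytic continuations, along paths in
`ℂ - {0,1}` from `1/2` to `x`, of the rows of its principal branch. -/
def polylogFib (n : ℕ) (x : ℂ) : Submodule ℚ (Fin (n + 1) → ℂ) :=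
  Submodule.span ℚ {y | ∃ (j : Fin (n + 1)) (γ : Path (1 / 2 : ℂ) x)
    (c : unitInterval → ℂ → Fin (n + 1) → ℂ),
    IsContinuationAlong ({0, 1}ᶜ : Set ℂ) (fun z k => polylogMatrix n z j k) γ c ∧ y = c 1 x}

/-- The standard basis vector `e_j` of `ℂ^{n+1}`. -/
def stdVec (n : ℕ) (j : Fin (n + 1)) : Fin (n + 1) → ℂ := Pi.single j 1

/-- `W_{-2l+1} = W_{-2l} = span {e_l, …, e_n}`, i.e. `e_j` has weight `-2j`. -/
def polylogW (n : ℕ) (w : ℤ) : Submodule ℂ (Fin (n + 1) → ℂ) :=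
  Submodule.span ℂ (stdVec n '' {j | -2 * (j : ℤ) ≤ w})

/-- `F^{-p} = span {e_0, …, e_p}`. -/
def polylogF (n : ℕ) (p : ℤ) : Submodule ℂ (Fin (n + 1) → ℂ) :=
  Submodule.span ℂ (stdVec n '' {j | (j : ℤ) ≤ -p})

theorem strictUpper_pow {n : ℕ} {A : Matrix (Fin n) (Fin n) ℂ}
    (h : ∀ i j : Fin n, (j : ℕ) ≤ i → A i j = 0) (k : ℕ) :
    ∀ i j : Fin n, (j : ℕ) < i + k → (A ^ k) i j = 0 := by
  induction k with
  | zero =>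
    intro i j hij
    rw [pow_zero, Matrix.one_apply_ne]
    rintro rfl
    omega
  | succ k ih =>
    intro i j hij
    rw [pow_succ, Matrix.mul_apply]
    refine Finset.sum_eq_zero fun l _ => ?_
    by_cases hl : (l : ℕ) < i + k
    · rw [ih i l hl, zero_mul]
    · rw [h l j (by omega), mul_zero]

theorem strictUpper_isNilpotent {n : ℕ} {A : Matrix (Fin n) (Fin n) ℂ}
    (h : ∀ i j : Fin n, (j : ℕ) ≤ i → A i j = 0) : IsNilpotent A :=
  ⟨n, by ext i j; exact strictUpper_pow h n i j (by omega)⟩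

/-- A superdiagonal matrix maps `span {e_j : j ∈ S}` to `span {e_j : j ∈ S'}` if `S + 1 ⊆ S'`. -/
theorem span_vecMul_mem {n : ℕ} {A : Matrix (Fin (n + 1)) (Fin (n + 1)) ℂ}
    (h : ∀ i j : Fin (n + 1), (j : ℕ) ≠ i + 1 → A i j = 0) {S S' : Set (Fin (n + 1))}
    (hS : ∀ i ∈ S, ∀ j : Fin (n + 1), (j : ℕ) = i + 1 → j ∈ S') {v : Fin (n + 1) → ℂ}
    (hv : v ∈ Submodule.span ℂ (stdVec n '' S)) :
    v ᵥ* A ∈ Submodule.span ℂ (stdVec n '' S') := by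
  induction hv using Submodule.span_induction with
  | mem x hx =>
    obtain ⟨i, hi, rfl⟩ := hx
    have : stdVec n i ᵥ* A = ∑ j, A i j • stdVec n j := by
      ext k
      simp [stdVec, Finset.sum_apply, Pi.single_apply]
    rw [this]
    refine Submodule.sum_mem _ fun j _ => ?_
    by_cases hj : (j : ℕ) = i + 1
    · exact Submodule.smul_mem _ _ (Submodule.subset_span ⟨j, hS i hi j hj, rfl⟩)
    · rw [h i j hj, zero_smul]
      exact Submodule.zero_mem _
  | zero => simp
  | add x y _ _ hx hy => rw [Matrix.add_vecMul]; exact Submodule.add_mem _ hx hy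
  | smul a x _ hx => rw [Matrix.smul_vecMul]; exact Submodule.smul_mem _ _ hx

/-- The `n`th polylogarithm variation. -/
def polylogVariation (n : ℕ) : LogVariation (Fin (n + 1)) where
  D := {0, 1}
  conn := polylogConn n
  res := polylogRes n
  conn_eq := by
    intro z hz
    have h1 : (1 : ℂ) - z = -(z - 1) := by ring
    ext j k
    simp only [Finset.sum_pair (zero_ne_one' ℂ), polylogConn, polylogRes, Matrix.add_apply,
      Matrix.smul_apply, Matrix.of_apply, smul_eq_mul, h1]
    split_ifs <;> simp_all [neg_inv]
  res_nilpotent := by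
    intro p _
    refine strictUpper_isNilpotent fun i j hij => ?_
    simp only [polylogRes, Matrix.of_apply]
    rw [if_neg (by omega)]
  res_infty_nilpotent := by
    refine (strictUpper_isNilpotent fun i j hij => ?_).neg
    rw [Matrix.sum_apply]
    refine Finset.sum_eq_zero fun p _ => ?_
    simp only [polylogRes, Matrix.of_apply]
    rw [if_neg (by omega)]
  fib := polylogFib n
  W := polylogW n
  F := polylogF n
  griffiths := by
    intro z _ p v hv
    refine span_vecMul_mem (fun i j hij => ?_) (fun i hi j hj => ?_) hv
    · simp only [polylogConn, Matrix.of_apply]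
      rw [if_neg hij]
    · simp only [Set.mem_ofPred_eq] at hi ⊢
      omega
  weight_flat := by
    intro z _ w v hv
    refine span_vecMul_mem (fun i j hij => ?_) (fun i hi j hj => ?_) hv
    · simp only [polylogConn, Matrix.of_apply]
      rw [if_neg hij]
    · simp only [Set.mem_ofPred_eq] at hi ⊢
      omega
  weight_res := by
    intro p _ w v hv
    refine span_vecMul_mem (fun i j hij => ?_) (fun i hi j hj => ?_) hv
    · simp only [polylogRes, Matrix.of_apply]
      rw [if_neg hij]
    · simp only [Set.mem_ofPred_eq] at hi ⊢
      omega

/-- The vectors `e_0` and `(2πi)^j e_j`, `1 ≤ j ≤ n`. -/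
def limitVecZero (n : ℕ) (j : Fin (n + 1)) : Fin (n + 1) → ℂ :=
  (2 * Real.pi * Complex.I : ℂ) ^ (j : ℕ) • stdVec n j

/-- The vectors `e_0 + ∑_{2 ≤ k ≤ n} ζ(k) e_k` and `(2πi)^j e_j`, `1 ≤ j ≤ n`. -/
def limitVecOne (n : ℕ) (j : Fin (n + 1)) : Fin (n + 1) → ℂ :=
  if (j : ℕ) = 0 then
    stdVec n 0 + ∑ k : Fin (n + 1), (if 2 ≤ (k : ℕ) then riemannZeta (k : ℕ) else 0) • stdVec n k
  else (2 * Real.pi * Complex.I : ℂ) ^ (j : ℕ) • stdVec n j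

/-- The complexified weight filtration and the Hodge filtration of `H` are
`W_{-2l+1} = W_{-2l} = span {e_l, …, e_n}` and `F^{-p} = span {e_0, …, e_p}`. -/
def HasPolylogFiltrations (n : ℕ) (H : MixedHodgeStructure (Fin (n + 1) → ℂ)) : Prop :=
  (∀ l : ℤ,
    Submodule.span ℂ (H.W (-2 * l) : Set (Fin (n + 1) → ℂ)) =
      Submodule.span ℂ (stdVec n '' {j | l ≤ (j : ℤ)}) ∧
    Submodule.span ℂ (H.W (-2 * l + 1) : Set (Fin (n + 1) → ℂ)) =
      Submodule.span ℂ (stdVec n '' {j | l ≤ (j : ℤ)})) ∧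
  ∀ p : ℤ, H.F (-p) = Submodule.span ℂ (stdVec n '' {j | (j : ℤ) ≤ p})

end Polylog

end

/-! The limit can be read off from one good flat frame. Put `z = P + v t` and `t = exp w`. Suppose a
flat frame `S(w)`, whose rows span the rational local system, factors as `exp (w J / 2πi) M(t)` with
`J` rational and nilpotent and `M` continuous at `t = 0`. Then the monodromy is `exp J`, so `N = J /
2πi` and `t^{-N} S = M(t)`, and the limit rational structure is spanned by the rows of `M(0)`.
`IsLocalModel` records such a frame.

No other choice changes the answer (`LimitChoice.rationalForm_eq`). Another chart, with parameter
`exp u`, has `w = u + h(exp u)` and `h(0) = -log λ`. Any rational flat basis is `R S(w)` with a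
constant `R` in `GL(ℚ)`, so `N` becomes `R (J / 2πi) R⁻¹`. The limit at the origin is then `R exp
(-log λ · J / 2πi) M(0)`, and `λ^N` turns it into `R M(0)`, which has the same rational row span as
`M(0)`.

The frames are explicit. Near `0` the polylogarithms are holomorphic and vanish at `0`, and `log z =
w` enters only through the exponential factor; this leaves `M(0) = diag ((2πi)^j)`. Near `1` the
function `ln_k x + log (1 - x) log^(k-1) x / (k-1)!` extends holomorphically, with value `0` for `k
= 1` and `ζ(k)` for `k ≥ 2` (`polylog_eq_polylogReg`). Here `log (1 - z) = w` enters only through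
the exponential factor, and the zeta values remain in the first row of `M(0)`.

The fibres are defined by all analytic continuations. Changing the branch of `log z` or of `log (1 -
z)` multiplies the frame on the left by a rational unipotent matrix, so continuation preserves the
rational span; conversely one explicit path to each point reaches the whole span
(`polylogFib_eq_branchSpan`).

The mixed Hodge axioms hold because `M(0)` is triangular with non-zero diagonal: each non-zero
graded piece is a line spanned by the class of `e_l`, of type `(-l, -l)`. -/

noncomputable section

/-! ### Primitives on star-shaped domains -/

/-- The integral of `f` along the segment from `a` to `z`. -/
def segmentIntegral (a : ℂ) (f : ℂ → ℂ) (z : ℂ) : ℂ :=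
  ∫ t in (0 : ℝ)..1, (z - a) * f (a + t • (z - a))

theorem segmentIntegral_self (a : ℂ) (f : ℂ → ℂ) : segmentIntegral a f a = 0 := by
  simp [segmentIntegral]

/-- Differentiation under the integral sign. The `z`-derivative of the integrand is also the
`t`-derivative of `t f(a + t (z - a))`, so its integral over `[0, 1]` is `f z`. -/
theorem hasDerivAt_segmentIntegral {U : Set ℂ} (hU : IsOpen U) {a : ℂ} (hs : StarConvex ℝ a U)
    {f : ℂ → ℂ} (hf : DifferentiableOn ℂ f U) {z : ℂ} (hz : z ∈ U) :
    HasDerivAt (segmentIntegral a f) (f z) z := by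
  obtain ⟨r, hr, hrU⟩ := Metric.nhds_basis_closedBall.mem_iff.1 (hU.mem_nhds hz)
  have hmem : ∀ t ∈ Set.Icc (0 : ℝ) 1, ∀ y ∈ Metric.closedBall z r, a + t • (y - a) ∈ U :=
    fun t ht y hy => hs.add_smul_sub_mem (hrU hy) ht.1 ht.2
  have hf' : ContinuousOn (deriv f) U := (hf.deriv hU).continuousOn
  let F' : ℂ → ℝ → ℂ := fun y t =>
    f (a + t • (y - a)) + (y - a) * (t * deriv f (a + t • (y - a)))
  have hcont : ContinuousOn (fun p : ℝ × ℂ => F' p.2 p.1)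
      (Set.Icc (0 : ℝ) 1 ×ˢ Metric.closedBall z r) := by
    have h1 : ContinuousOn (fun p : ℝ × ℂ => a + p.1 • (p.2 - a))
      (Set.Icc (0 : ℝ) 1 ×ˢ Metric.closedBall z r) := by fun_prop
    have h2 : Set.MapsTo (fun p : ℝ × ℂ => a + p.1 • (p.2 - a))
      (Set.Icc (0 : ℝ) 1 ×ˢ Metric.closedBall z r) U := fun p hp => hmem p.1 hp.1 p.2 hp.2
    have h3 := hf.continuousOn.comp h1 h2
    have h4 := hf'.comp h1 h2
    exact h3.add (ContinuousOn.mul (by fun_prop) (ContinuousOn.mul (by fun_prop) h4))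
  obtain ⟨C, hC⟩ := ((isCompact_Icc.prod (isCompact_closedBall z r)).exists_bound_of_continuousOn
    hcont)
  have hI : Set.uIoc (0 : ℝ) 1 ⊆ Set.Icc 0 1 := by
    rw [Set.uIoc_of_le zero_le_one]; exact Set.Ioc_subset_Icc_self
  have hseg : ∀ y ∈ Metric.closedBall z r,
      ContinuousOn (fun t : ℝ => (y - a) * f (a + t • (y - a))) (Set.Icc 0 1) := fun y hy =>
    continuousOn_const.mul (hf.continuousOn.comp (by fun_prop) fun t ht => hmem t ht y hy)
  have hz' : z ∈ Metric.closedBall z r := Metric.mem_closedBall_self hr.le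
  have hF'z : ContinuousOn (F' z) (Set.Icc 0 1) :=
    hcont.comp (f := fun t : ℝ => (t, z)) (by fun_prop) fun t ht => ⟨ht, hz'⟩
  have key := intervalIntegral.hasDerivAt_integral_of_dominated_loc_of_deriv_le
    (μ := MeasureTheory.volume) (a := 0) (b := 1)
    (F := fun y t => (y - a) * f (a + t • (y - a))) (F' := F') (bound := fun _ => C)
    (Metric.closedBall_mem_nhds z hr)
    (by
      filter_upwards [Metric.closedBall_mem_nhds z hr] with y hy
      exact ((hseg y hy).mono hI).aestronglyMeasurable measurableSet_uIoc)
    ((hseg z hz').intervalIntegrable_of_Icc zero_le_one)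
    ((hF'z.mono hI).aestronglyMeasurable measurableSet_uIoc)
    (Eventually.of_forall fun t ht y hy => hC (t, y) ⟨hI ht, hy⟩)
    intervalIntegrable_const
    (Eventually.of_forall fun t ht y hy => by
      have h1 : HasDerivAt (fun y : ℂ => a + t • (y - a)) (t : ℂ) y := by
        simpa using! (((hasDerivAt_id y).sub_const a).const_smul t).const_add a
      have h2 := ((hf.differentiableAt (hU.mem_nhds (hmem t (hI ht) y hy))).hasDerivAt).comp y h1
      convert! ((hasDerivAt_id y).sub_const a).mul h2 using 1
      simp only [F', id, Function.comp]
      ring)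
  convert! key.2 using 1
  have hd : ∀ t ∈ Set.uIcc (0 : ℝ) 1,
      HasDerivAt (fun t : ℝ => (t : ℂ) * f (a + t • (z - a))) (F' z t) t := by
    intro t ht
    rw [Set.uIcc_of_le zero_le_one] at ht
    have h1 : HasDerivAt (fun t : ℝ => a + t • (z - a)) (z - a) t := by
      simpa using! ((hasDerivAt_id t).smul_const (z - a)).const_add a
    have h2 := ((hf.differentiableAt (hU.mem_nhds (hmem t ht z hz'))).hasDerivAt).comp t h1
    convert! (Complex.ofRealCLM.hasDerivAt (x := t)).mul h2 using 1
    simp only [F', Complex.ofRealCLM_apply, Function.comp, Complex.ofReal_one]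
    ring
  rw [intervalIntegral.integral_eq_sub_of_hasDerivAt hd
    ((hF'z.intervalIntegrable_of_Icc zero_le_one))]
  simp

theorem IsOpen.eqOn_of_hasDerivAt_eq {U : Set ℂ} (hU : IsOpen U) (hc : IsPreconnected U)
    {f g f' : ℂ → ℂ} (hf : ∀ z ∈ U, HasDerivAt f (f' z) z) (hg : ∀ z ∈ U, HasDerivAt g (f' z) z) :
    ∃ C, ∀ z ∈ U, f z = g z + C := by
  obtain ⟨C, hC⟩ := hU.exists_is_const_of_deriv_eq_zero hc (f := fun z => f z - g z)
    (fun z hz => ((hf z hz).sub (hg z hz)).differentiableAt.differentiableWithinAt)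
    (fun z hz => by
      have := ((hf z hz).sub (hg z hz)).deriv
      rwa [sub_self] at this)
  exact ⟨C, fun z hz => by rw [← hC z hz]; ring⟩

/-! ### Polylogarithms on slit planes -/

/-- The plane cut along `[1, ∞)`. -/
def cutPlane : Set ℂ := {z | 1 - z ∈ Complex.slitPlane}

theorem isOpen_cutPlane : IsOpen cutPlane :=
  Complex.isOpen_slitPlane.preimage (by fun_prop)

theorem zero_mem_cutPlane : (0 : ℂ) ∈ cutPlane := by simp [cutPlane]

theorem one_notMem_cutPlane : (1 : ℂ) ∉ cutPlane := by simp [cutPlane]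

theorem starConvex_cutPlane {x : ℝ} (hx : x < 1) : StarConvex ℝ (x : ℂ) cutPlane := by
  have h : StarConvex ℝ (((1 - x : ℝ) : ℂ)) Complex.slitPlane :=
    Complex.starConvex_ofReal_slitPlane (by linarith)
  intro y hy s t hs ht hst
  have := h hy hs ht hst
  simp only [cutPlane, Set.mem_ofPred_eq]
  convert this using 1
  have : (s : ℂ) + t = 1 := by exact_mod_cast hst
  simp only [Complex.real_smul]
  push_cast
  linear_combination (-1 : ℂ) * this

theorem ball_subset_cutPlane : Metric.ball (0 : ℂ) 1 ⊆ cutPlane := by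
  intro z hz
  have := Complex.mem_slitPlane_of_norm_lt_one (z := -z) (by simpa using hz)
  simpa [cutPlane, sub_eq_add_neg] using this

theorem ball_one_subset_slitPlane : Metric.ball (1 : ℂ) 1 ⊆ Complex.slitPlane := by
  intro z hz
  have := Complex.mem_slitPlane_of_norm_lt_one (z := z - 1) (by simpa [dist_eq_norm] using hz)
  simpa using this

/-- The `k`th polylogarithm on the plane cut along `[1, ∞)`. -/
def polylog : ℕ → ℂ → ℂ
  | 0, z => z / (1 - z)
  | 1, z => -Complex.log (1 - z)
  | k + 2, z => segmentIntegral 0 (dslope (polylog (k + 1)) 0) z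

theorem hasDerivAt_polylog_one {z : ℂ} (hz : z ∈ cutPlane) :
    HasDerivAt (polylog 1) (1 / (1 - z)) z := by
  have h1 : HasDerivAt (fun z : ℂ => 1 - z) (-1) z := by
    simpa using (hasDerivAt_id z).const_sub 1
  have := (h1.clog hz).neg
  convert! this using 1
  ring

theorem polylog_zero_right {k : ℕ} : polylog k 0 = 0 := by
  match k with
  | 0 => simp [polylog]
  | 1 => simp [polylog]
  | k + 2 => exact segmentIntegral_self _ _

/-- `dslope` is `polylog (k + 1) z / z` with its removable singularity at `0` filled in, so the
primitive exists on all of `cutPlane`, which is star-shaped about `0`. -/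
theorem hasDerivAt_polylog_aux (k : ℕ) (hd : DifferentiableOn ℂ (polylog (k + 1)) cutPlane) :
    ∀ z ∈ cutPlane, HasDerivAt (polylog (k + 2)) (dslope (polylog (k + 1)) 0 z) z := by
  intro z hz
  have h := hasDerivAt_segmentIntegral isOpen_cutPlane
    (by simpa using starConvex_cutPlane zero_lt_one)
    ((Complex.differentiableOn_dslope (isOpen_cutPlane.mem_nhds zero_mem_cutPlane)).2 hd) hz
  exact h

theorem differentiableOn_polylog (k : ℕ) : DifferentiableOn ℂ (polylog (k + 1)) cutPlane := by
  induction k with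
  | zero => exact fun z hz => (hasDerivAt_polylog_one hz).differentiableAt.differentiableWithinAt
  | succ k ih =>
    exact fun z hz => (hasDerivAt_polylog_aux k ih z hz).differentiableAt.differentiableWithinAt

theorem hasDerivAt_polylog {k : ℕ} {z : ℂ} (hz : z ∈ cutPlane) (h0 : z ≠ 0) :
    HasDerivAt (polylog (k + 2)) (polylog (k + 1) z / z) z := by
  have h := hasDerivAt_polylog_aux k (differentiableOn_polylog k) z hz
  rwa [dslope_of_ne _ h0, slope_def_field, polylog_zero_right, sub_zero, sub_zero] at h

/-! ### The power series -/

theorem hasDerivAt_lnSeries (k : ℕ) {z : ℂ} (hz : z ∈ Metric.ball (0 : ℂ) 1) :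
    HasDerivAt (lnSeries (k + 1)) (∑' m : ℕ, z ^ m / ((m : ℂ) + 1) ^ k) z := by
  rw [mem_ball_zero_iff] at hz
  obtain ⟨r, hzr, hr⟩ := exists_between hz
  have hr0 : 0 ≤ r := (norm_nonneg z).trans hzr.le
  have hne : ∀ m : ℕ, (m : ℂ) + 1 ≠ 0 := fun m => by exact_mod_cast m.succ_ne_zero
  refine hasDerivAt_tsum_of_isPreconnected (u := fun m : ℕ => r ^ m)
    (summable_geometric_of_lt_one hr0 hr)
    (t := Metric.ball 0 r) Metric.isOpen_ball (convex_ball _ _).isPreconnected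
    (g := fun (m : ℕ) (z : ℂ) => z ^ (m + 1) / ((m : ℂ) + 1) ^ (k + 1))
    (g' := fun (m : ℕ) (z : ℂ) => z ^ m / ((m : ℂ) + 1) ^ k) (fun m y _ => ?_) (fun m y hy => ?_) (y₀ := 0)
    (Metric.mem_ball_self ((norm_nonneg z).trans_lt hzr)) ?_ (mem_ball_zero_iff.2 hzr)
  · have := (hasDerivAt_pow (m + 1) y).div_const (((m : ℂ) + 1) ^ (k + 1))
    convert! this using 1
    have := hne m
    push_cast
    field_simp
    ring
  · rw [mem_ball_zero_iff] at hy
    rw [norm_div, norm_pow, norm_pow]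
    have : (1 : ℝ) ≤ ‖(m : ℂ) + 1‖ := by
      have : ‖(m : ℂ) + 1‖ = (m : ℝ) + 1 := by
        rw [← Nat.cast_one, ← Nat.cast_add, Complex.norm_natCast]; simp
      rw [this]; simp
    refine (div_le_self (by positivity) (one_le_pow₀ this)).trans ?_
    gcongr
  · simp

theorem lnSeries_zero_right (k : ℕ) : lnSeries k 0 = 0 := by simp [lnSeries]

/-- By induction both sides are primitives of the same function on the unit disk and vanish at `0`.
-/
theorem lnSeries_eq_polylog (k : ℕ) {z : ℂ} (hz : z ∈ Metric.ball (0 : ℂ) 1) :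
    lnSeries (k + 1) z = polylog (k + 1) z := by
  induction k generalizing z with
  | zero =>
    have h := Complex.hasSum_taylorSeries_neg_log (z := z) (by simpa using hz)
    -- The term of index `0` is `z ^ 0 / 0 = 0`; dropping it gives the indexing of `lnSeries`.
    have h2 := (hasSum_nat_add_iff' 1).2 h
    simp only [Finset.sum_range_one, pow_zero, Nat.cast_zero, div_zero, sub_zero] at h2
    rw [zero_add, polylog, ← h2.tsum_eq, lnSeries]
    simp
  | succ k ih =>
    have hderiv : ∀ z ∈ Metric.ball (0 : ℂ) 1,
        HasDerivAt (lnSeries (k + 2)) (dslope (polylog (k + 1)) 0 z) z := by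
      have hA : ∀ z ∈ Metric.ball (0 : ℂ) 1, z ≠ 0 →
          (∑' m : ℕ, z ^ m / ((m : ℂ) + 1) ^ (k + 1)) = dslope (polylog (k + 1)) 0 z := by
        intro z hz h0
        rw [dslope_of_ne _ h0, slope_def_field, polylog_zero_right, sub_zero, sub_zero,
          ← ih hz, lnSeries, ← tsum_div_const]
        refine tsum_congr fun m => ?_
        field_simp
        ring
      intro z hz
      have h := hasDerivAt_lnSeries (k + 1) hz
      -- At `0` the difference quotient is a derivative; by the induction hypothesis it is the
      -- leading coefficient `1` of the series.
      by_cases h0 : z = 0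
      · subst h0
        convert h using 1
        rw [dslope_same]
        have h1 : HasDerivAt (polylog (k + 1)) (∑' m : ℕ, (0 : ℂ) ^ m / ((m : ℂ) + 1) ^ k) 0 :=
          (hasDerivAt_lnSeries k hz).congr_of_eventuallyEq
            (by filter_upwards [Metric.isOpen_ball.mem_nhds hz] with y hy using (ih hy).symm)
        rw [h1.deriv, tsum_eq_single 0 (by intro m hm; simp [hm]),
          tsum_eq_single 0 (by intro m hm; simp [hm])]
        simp
      · rwa [← hA z hz h0]
    obtain ⟨C, hC⟩ := Metric.isOpen_ball.eqOn_of_hasDerivAt_eq (convex_ball (0 : ℂ) 1).isPreconnected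
      hderiv fun z hz => hasDerivAt_polylog_aux k (differentiableOn_polylog k) z
        (ball_subset_cutPlane hz)
    have h0 := hC 0 (by simp)
    rw [lnSeries_zero_right, polylog_zero_right, zero_add] at h0
    rw [hC z hz, ← h0, add_zero]

/-! ### Behaviour of the polylogarithms at `1` -/

theorem tendsto_lnSeries_one {k : ℕ} (hk : 2 ≤ k) :
    Tendsto (fun x : ℝ => lnSeries k x) (𝓝[<] 1) (𝓝 (riemannZeta k)) := by
  have hnorm : ∀ m : ℕ, ‖(m : ℂ) + 1‖ = (m : ℝ) + 1 := fun m => by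
    rw [← Nat.cast_one, ← Nat.cast_add, Complex.norm_natCast]; simp
  have hs : Summable fun m : ℕ => 1 / ((m : ℝ) + 1) ^ k := by
    have := (summable_nat_add_iff 1).2 (Real.summable_one_div_nat_pow.2 (by omega : 1 < k))
    simpa using this
  -- For `k ≥ 2` the series converges uniformly on the closed disk, so the boundary value is
  -- obtained by continuity.
  have hc : ContinuousOn (lnSeries k) (Metric.closedBall 0 1) := by
    refine continuousOn_tsum (fun m => by fun_prop) hs fun m x hx => ?_
    rw [mem_closedBall_zero_iff] at hx
    rw [norm_div, norm_pow, norm_pow, hnorm]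
    gcongr
    exact pow_le_one₀ (norm_nonneg _) hx
  have h1 : lnSeries k 1 = riemannZeta k := by
    rw [zeta_nat_eq_tsum_of_gt_one (by omega), lnSeries]
    -- The zeta series is summed from `0`; its first term is a division by zero, with value `0`.
    have h0 : (1 : ℂ) / ((0 : ℕ) : ℂ) ^ k = 0 := by
      rw [Nat.cast_zero, zero_pow (by omega), div_zero]
    have hsum : Summable fun m : ℕ => 1 / (m : ℂ) ^ k := by
      refine Summable.of_norm ?_
      simpa using Real.summable_one_div_nat_pow.2 (by omega : 1 < k)
    rw [hsum.tsum_eq_zero_add, h0, zero_add]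
    simp
  rw [← h1]
  have := (hc 1 (by simp)).tendsto
  refine this.comp (tendsto_nhdsWithin_iff.2 ⟨?_, ?_⟩)
  · exact (Complex.continuous_ofReal.tendsto' 1 1 (by simp)).mono_left nhdsWithin_le_nhds
  · filter_upwards [Ioo_mem_nhdsLT (zero_lt_one' ℝ)] with x hx
    rw [mem_closedBall_zero_iff, Complex.norm_real, Real.norm_eq_abs, abs_of_pos hx.1]
    exact hx.2.le

/-- The holomorphic function on the plane cut along `(-∞, 0]` to which
`x ↦ ln_k x + log (1 - x) log^(k-1) x / (k-1)!` extends. -/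
def polylogReg : ℕ → ℂ → ℂ
  | 0, _ => 0
  | 1, _ => 0
  | k + 2, z => riemannZeta (k + 2 : ℕ) + segmentIntegral 1 (fun w => polylogReg (k + 1) w / w +
      dslope Complex.log 1 w * Complex.log w ^ k / (k + 1).factorial) z

theorem polylogReg_one_right {k : ℕ} (hk : 2 ≤ k) : polylogReg k 1 = riemannZeta k := by
  obtain ⟨k, rfl⟩ := Nat.exists_eq_add_of_le' hk
  rw [polylogReg, segmentIntegral_self, add_zero]

theorem differentiableOn_clog : DifferentiableOn ℂ Complex.log Complex.slitPlane :=
  fun _ hz => (Complex.hasDerivAt_log hz).differentiableAt.differentiableWithinAt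

theorem differentiableOn_dslope_clog :
    DifferentiableOn ℂ (dslope Complex.log 1) Complex.slitPlane :=
  (Complex.differentiableOn_dslope
    (Complex.isOpen_slitPlane.mem_nhds Complex.one_mem_slitPlane)).2 differentiableOn_clog

/-- `dslope Complex.log 1 w` is `log w / (w - 1)` with the singularity at `1` removed. This keeps
the integrand holomorphic on the whole slit plane, including the point `1` where the limit is taken.
-/
theorem hasDerivAt_polylogReg_aux (k : ℕ)
    (hd : DifferentiableOn ℂ (polylogReg (k + 1)) Complex.slitPlane) :
    ∀ z ∈ Complex.slitPlane, HasDerivAt (polylogReg (k + 2)) (polylogReg (k + 1) z / z +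
      dslope Complex.log 1 z * Complex.log z ^ k / (k + 1).factorial) z := by
  intro z hz
  have hf : DifferentiableOn ℂ (fun w => polylogReg (k + 1) w / w +
      dslope Complex.log 1 w * Complex.log w ^ k / (k + 1).factorial) Complex.slitPlane :=
    (hd.div differentiableOn_id fun w hw => Complex.slitPlane_ne_zero hw).add
      ((differentiableOn_dslope_clog.mul (differentiableOn_clog.pow k)).div_const _)
  exact (hasDerivAt_segmentIntegral Complex.isOpen_slitPlane Complex.starConvex_one_slitPlane
    hf hz).const_add _

theorem differentiableOn_polylogReg (k : ℕ) :
    DifferentiableOn ℂ (polylogReg (k + 1)) Complex.slitPlane := by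
  induction k with
  | zero => exact differentiableOn_const 0
  | succ k ih =>
    exact fun z hz => (hasDerivAt_polylogReg_aux k ih z hz).differentiableAt.differentiableWithinAt

theorem hasDerivAt_polylogReg {k : ℕ} {z : ℂ} (hz : z ∈ Complex.slitPlane) (h1 : z ≠ 1) :
    HasDerivAt (polylogReg (k + 2)) (polylogReg (k + 1) z / z -
      Complex.log z ^ (k + 1) / ((k + 1).factorial * (1 - z))) z := by
  convert! hasDerivAt_polylogReg_aux k (differentiableOn_polylogReg k) z hz using 1
  rw [dslope_of_ne _ h1, slope_def_field, Complex.log_one, sub_zero]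
  have h2 : z - 1 ≠ 0 := sub_ne_zero.2 h1
  have h3 : 1 - z ≠ 0 := sub_ne_zero.2 h1.symm
  have h4 : ((k + 1).factorial : ℂ) ≠ 0 := by exact_mod_cast (k + 1).factorial_ne_zero
  field_simp
  ring

theorem hasDerivAt_pow_div_factorial {f : ℂ → ℂ} {f' z : ℂ} (hf : HasDerivAt f f' z) (k : ℕ) :
    HasDerivAt (fun z => f z ^ (k + 1) / (k + 1).factorial) (f z ^ k / k.factorial * f') z := by
  have h4 : (k.factorial : ℂ) ≠ 0 := by exact_mod_cast k.factorial_ne_zero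
  have h5 : (k : ℂ) + 1 ≠ 0 := by exact_mod_cast k.succ_ne_zero
  convert! (hf.pow (k + 1)).div_const ((k + 1).factorial : ℂ) using 1
  rw [Nat.factorial_succ]
  push_cast
  field_simp

/-- One factor `log x` equals `(1 - x)` times a function bounded near `1`, and `(1 - x) log (1 - x)`
tends to `0`. -/
theorem tendsto_log_mul_log_pow (k : ℕ) :
    Tendsto (fun x : ℝ => Complex.log (1 - x) * (Complex.log x ^ (k + 1) / (k + 1).factorial))
      (𝓝[<] 1) (𝓝 0) := by
  have hofReal : Tendsto (fun x : ℝ => (x : ℂ)) (𝓝[<] 1) (𝓝 1) :=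
    (Complex.continuous_ofReal.tendsto' 1 1 (by simp)).mono_left nhdsWithin_le_nhds
  have hn := Complex.isOpen_slitPlane.mem_nhds Complex.one_mem_slitPlane
  have h1 : Tendsto (fun x : ℝ => dslope Complex.log 1 x) (𝓝[<] 1)
      (𝓝 (dslope Complex.log 1 1)) :=
    ((differentiableOn_dslope_clog.continuousOn.continuousAt hn).tendsto).comp hofReal
  have h2 : Tendsto (fun x : ℝ => Complex.log x) (𝓝[<] 1) (𝓝 (Complex.log 1)) :=
    ((differentiableOn_clog.continuousOn.continuousAt hn).tendsto).comp hofReal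
  have h3 : Tendsto (fun x : ℝ => (((1 - x) * Real.log (1 - x) : ℝ) : ℂ)) (𝓝[<] 1) (𝓝 0) := by
    have : Continuous fun x : ℝ => (((1 - x) * Real.log (1 - x) : ℝ) : ℂ) :=
      Complex.continuous_ofReal.comp (Real.continuous_mul_log.comp (by fun_prop))
    exact (this.tendsto' 1 0 (by simp)).mono_left nhdsWithin_le_nhds
  have h := (h3.mul (h1.neg.mul (h2.pow k))).div_const ((k + 1).factorial : ℂ)
  rw [zero_mul, zero_div] at h
  refine h.congr' ?_
  filter_upwards [Ioo_mem_nhdsLT (zero_lt_one' ℝ)] with x hx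
  have hx1 : (x : ℂ) ≠ 1 := by exact_mod_cast hx.2.ne
  rw [dslope_of_ne _ hx1, slope_def_field, Complex.log_one, sub_zero]
  have e : Complex.log (1 - x) = (Real.log (1 - x) : ℝ) := by
    rw [Complex.ofReal_log (by linarith [hx.2])]; push_cast; rfl
  rw [e]
  have h2 : (x : ℂ) - 1 ≠ 0 := sub_ne_zero.2 hx1
  have h4 : ((k + 1).factorial : ℂ) ≠ 0 := by exact_mod_cast (k + 1).factorial_ne_zero
  push_cast
  field_simp
  ring

theorem ofReal_mem_cutPlane {x : ℝ} (hx : x < 1) : (x : ℂ) ∈ cutPlane := by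
  have := Complex.ofReal_mem_slitPlane.2 (sub_pos.2 hx)
  simpa [cutPlane] using this

/-- By induction both sides have the same derivative on the intersection of the two cut planes,
which is connected because it is star-shaped about `1/2`. -/
theorem polylog_eq_polylogReg (k : ℕ) {z : ℂ} (h0 : z ∈ Complex.slitPlane) (h1 : z ∈ cutPlane) :
    polylog (k + 1) z = polylogReg (k + 1) z -
      Complex.log (1 - z) * (Complex.log z ^ k / k.factorial) := by
  induction k generalizing z with
  | zero => simp [polylog, polylogReg]
  | succ k ih =>
    have hne1 : ∀ z ∈ cutPlane, z ≠ 1 := by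
      rintro z hz rfl
      exact one_notMem_cutPlane hz
    have hpc : IsPreconnected (Complex.slitPlane ∩ cutPlane) := by
      have h := (Complex.starConvex_ofReal_slitPlane (x := 1 / 2) (by norm_num)).inter
        (starConvex_cutPlane (x := 1 / 2) (by norm_num))
      exact (h.isPathConnected ⟨Complex.ofReal_mem_slitPlane.2 (by norm_num),
        ofReal_mem_cutPlane (by norm_num)⟩).isConnected.isPreconnected
    obtain ⟨C, hC⟩ := (Complex.isOpen_slitPlane.inter isOpen_cutPlane).eqOn_of_hasDerivAt_eq hpc
      (f := polylog (k + 2)) (g := fun z => polylogReg (k + 2) z -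
        Complex.log (1 - z) * (Complex.log z ^ (k + 1) / (k + 1).factorial))
      (fun z hz => hasDerivAt_polylog hz.2 (Complex.slitPlane_ne_zero hz.1))
      (fun z hz => by
        have hl : HasDerivAt (fun z : ℂ => Complex.log (1 - z)) (-1 / (1 - z)) z := by
          have h1 : HasDerivAt (fun z : ℂ => 1 - z) (-1) z := by
            simpa using (hasDerivAt_id z).const_sub 1
          exact h1.clog hz.2
        have hz0 := Complex.slitPlane_ne_zero hz.1
        convert! (hasDerivAt_polylogReg hz.1 (hne1 z hz.2)).sub (hl.mul
          (hasDerivAt_pow_div_factorial (Complex.hasDerivAt_log hz.1) k)) using 1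
        rw [ih hz.1 hz.2]
        have h3 : 1 - z ≠ 0 := sub_ne_zero.2 (hne1 z hz.2).symm
        have h4 : ((k + 1).factorial : ℂ) ≠ 0 := by exact_mod_cast (k + 1).factorial_ne_zero
        have h5 : (k.factorial : ℂ) ≠ 0 := by exact_mod_cast k.factorial_ne_zero
        field_simp
        ring)
    -- The constant is found by letting real `x` tend to `1` from below: the series and `polylogReg`
    -- both tend to `ζ(k + 2)`, and the logarithmic term tends to `0`.
    suffices C = 0 by rw [hC z ⟨h0, h1⟩, this, add_zero]
    have hofReal : Tendsto (fun x : ℝ => (x : ℂ)) (𝓝[<] 1) (𝓝 1) :=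
      (Complex.continuous_ofReal.tendsto' 1 1 (by simp)).mono_left nhdsWithin_le_nhds
    have hn := Complex.isOpen_slitPlane.mem_nhds Complex.one_mem_slitPlane
    have t1 : Tendsto (fun x : ℝ => polylogReg (k + 2) x) (𝓝[<] 1)
        (𝓝 (riemannZeta (k + 2 : ℕ))) := by
      rw [← polylogReg_one_right (by omega : 2 ≤ k + 2)]
      exact (((differentiableOn_polylogReg (k + 1)).continuousOn.continuousAt hn).tendsto).comp
        hofReal
    have t := (tendsto_lnSeries_one (by omega : 2 ≤ k + 2)).sub
      (t1.sub (tendsto_log_mul_log_pow k))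
    rw [sub_zero, sub_self] at t
    refine tendsto_nhds_unique (tendsto_const_nhds.congr' ?_) t
    filter_upwards [Ioo_mem_nhdsLT (zero_lt_one' ℝ)] with x hx
    have hb : (x : ℂ) ∈ Metric.ball (0 : ℂ) 1 := by
      rw [mem_ball_zero_iff, Complex.norm_real, Real.norm_eq_abs, abs_of_pos hx.1]
      exact hx.2
    rw [lnSeries_eq_polylog (k + 1) hb,
      hC x ⟨Complex.ofReal_mem_slitPlane.2 hx.1, ofReal_mem_cutPlane hx.2⟩]
    ring

/-! ### Rational spans of rows -/

section RatRows

set_option linter.unusedSectionVars false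

variable {ι : Type*} [Fintype ι] [DecidableEq ι]

/-- A rational matrix viewed as a complex one. -/
abbrev ratMat (R : Matrix ι ι ℚ) : Matrix ι ι ℂ := R.map (Rat.cast : ℚ → ℂ)

theorem ratMat_mul (R S : Matrix ι ι ℚ) : ratMat (R * S) = ratMat R * ratMat S :=
  Matrix.map_mul (f := Rat.castHom ℂ)

theorem ratMat_one : ratMat (1 : Matrix ι ι ℚ) = 1 :=
  Matrix.map_one (Rat.castHom ℂ) (map_zero _) (map_one _)

theorem ratMat_injective : Function.Injective (ratMat (ι := ι)) :=
  Matrix.map_injective Rat.cast_injective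

/-- The rational span of the rows of a complex matrix. -/
def ratRows (M : Matrix ι ι ℂ) : Submodule ℚ (ι → ℂ) := Submodule.span ℚ (Set.range fun i => M i)

theorem mem_ratRows {M : Matrix ι ι ℂ} {v : ι → ℂ} :
    v ∈ ratRows M ↔ ∃ a : ι → ℚ, (fun i => (a i : ℂ)) ᵥ* M = v := by
  rw [ratRows, Submodule.mem_span_range_iff_exists_fun]
  refine exists_congr fun a => ?_
  rw [Matrix.vecMul_eq_sum]
  have : ∀ i, a i • M i = (a i : ℂ) • M i := fun i => by
    ext k
    simp [Rat.smul_def]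
  simp_rw [this]

/-- In this form inclusions of rational spans can be composed, and they commute with right
multiplication by complex matrices. -/
theorem ratRows_le_iff {A B : Matrix ι ι ℂ} :
    ratRows A ≤ ratRows B ↔ ∃ R : Matrix ι ι ℚ, A = ratMat R * B := by
  constructor
  · intro h
    have : ∀ i, ∃ a : ι → ℚ, (fun i => (a i : ℂ)) ᵥ* B = A i := fun i =>
      mem_ratRows.1 (h (Submodule.subset_span ⟨i, rfl⟩))
    choose a ha using this
    refine ⟨Matrix.of a, ?_⟩
    ext i k
    rw [← ha i]
    rfl
  · rintro ⟨R, rfl⟩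
    refine Submodule.span_le.2 ?_
    rintro _ ⟨i, rfl⟩
    exact mem_ratRows.2 ⟨R i, rfl⟩

theorem ratRows_eq_of_mul {R S : Matrix ι ι ℚ} (h : S * R = 1) (M : Matrix ι ι ℂ) :
    ratRows (ratMat R * M) = ratRows M :=
  le_antisymm (ratRows_le_iff.2 ⟨R, rfl⟩)
    (ratRows_le_iff.2 ⟨S, by rw [← Matrix.mul_assoc, ← ratMat_mul, h, ratMat_one, Matrix.one_mul]⟩)

theorem ratRows_mul_eq_iff {A A' B : Matrix ι ι ℂ} (hB : IsUnit B.det) :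
    ratRows (A * B) = ratRows (A' * B) ↔ ratRows A = ratRows A' := by
  have key : ∀ A A' : Matrix ι ι ℂ, ratRows (A * B) ≤ ratRows (A' * B) ↔
      ratRows A ≤ ratRows A' := by
    intro A A'
    simp_rw [ratRows_le_iff]
    refine exists_congr fun R => ?_
    rw [← Matrix.mul_assoc]
    exact ⟨fun h => by
      simpa [Matrix.mul_assoc, Matrix.mul_nonsing_inv _ hB] using congrArg (· * B⁻¹) h,
      fun h => by rw [h]⟩
  rw [le_antisymm_iff, le_antisymm_iff, key, key]

/-- Two frames with the same rational span differ by an element of `GL(ℚ)`: cancelling `B` leaves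
`A` and the identity with equal row spans. -/
theorem exists_ratMat_of_ratRows_mul_eq {A B : Matrix ι ι ℂ} (hB : IsUnit B.det)
    (h : ratRows (A * B) = ratRows B) :
    ∃ R S : Matrix ι ι ℚ, A = ratMat R ∧ S * R = 1 := by
  have h' : ratRows (A * B) = ratRows (1 * B) := by rwa [Matrix.one_mul]
  rw [ratRows_mul_eq_iff hB] at h'
  obtain ⟨R, hR⟩ := ratRows_le_iff.1 h'.le
  obtain ⟨S, hS⟩ := ratRows_le_iff.1 h'.ge
  rw [Matrix.mul_one] at hR
  refine ⟨R, S, hR, ratMat_injective ?_⟩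
  rw [ratMat_mul, ← hR, ← hS, ratMat_one]

end RatRows

/-! ### Exponentials and logarithms of nilpotent matrices -/

section Exp

variable {ι : Type*} [Fintype ι] [DecidableEq ι]

open NormedSpace

theorem normedSpace_exp_eq_isNilpotent_exp {A : Matrix ι ι ℂ} (h : IsNilpotent A) :
    exp A = IsNilpotent.exp A := by
  obtain ⟨k, hk⟩ := h
  rw [IsNilpotent.exp_eq_sum hk, exp_eq_tsum ℂ]
  change ∑' n : ℕ, (n.factorial : ℂ)⁻¹ • A ^ n = _
  rw [tsum_eq_sum (s := Finset.range k)]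
  · refine Finset.sum_congr rfl fun i _ => ?_
    ext a b
    simp [Rat.smul_def]
  · intro m hm
    rw [pow_eq_zero_of_le (by simpa using hm) hk, smul_zero]

theorem exp_ratMat {J : Matrix ι ι ℚ} (h : IsNilpotent J) :
    exp (ratMat J) = ratMat (IsNilpotent.exp J) := by
  have h' : IsNilpotent (ratMat J) := h.map ((Rat.castHom ℂ).mapMatrix (m := ι))
  rw [normedSpace_exp_eq_isNilpotent_exp h']
  exact (IsNilpotent.map_exp h ((Rat.castHom ℂ).mapMatrix (m := ι))).symm

/-- The exponential of a rational nilpotent matrix is a finite sum, hence rational, and its inverse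
is rational too. -/
theorem ratRows_exp_mul {J : Matrix ι ι ℚ} (h : IsNilpotent J) (M : Matrix ι ι ℂ) :
    ratRows (exp (ratMat J) * M) = ratRows M := by
  rw [exp_ratMat h]
  exact ratRows_eq_of_mul (IsNilpotent.exp_neg_mul_exp_self h) M

open scoped Norms.Operator in
theorem hasDerivAt_matrix_exp (A : Matrix ι ι ℂ) (s : ℂ) :
    HasDerivAt (fun s : ℂ => exp (s • A)) (exp (s • A) * A) s :=
  hasDerivAt_exp_smul_const A s

-- The derivative of `s ↦ log (exp (s A)) - s A` vanishes: the derivative of the truncated logarithm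
-- contains a truncated geometric series, which is exactly the inverse of `exp (s A)` because `exp
-- (s A) - 1` is nilpotent of the right order.
open scoped Norms.Operator in
theorem unipotentLog_exp {A : Matrix ι ι ℂ} (hA : A ^ Fintype.card ι = 0) :
    unipotentLog (exp A) = A := by
  set N := Fintype.card ι
  have hnil : ∀ s : ℂ, IsNilpotent (s • A) := fun s => ⟨N, by rw [smul_pow, hA, smul_zero]⟩
  have hpow : ∀ s : ℂ, (exp (s • A) - 1) ^ N = 0 := by
    intro s
    -- Exponent `N + 1` rather than `N`: splitting off the constant term `1` leaves `N` terms
    -- divisible by `s A`.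
    have h : (s • A) ^ (N + 1) = 0 := by rw [pow_succ, smul_pow, hA, smul_zero, zero_mul]
    obtain ⟨C, hC, hc⟩ : ∃ C, exp (s • A) - 1 = (s • A) * C ∧ Commute (s • A) C := by
      refine ⟨∑ i ∈ Finset.range N, ((i + 1).factorial : ℚ)⁻¹ • (s • A) ^ i, ?_, ?_⟩
      · rw [normedSpace_exp_eq_isNilpotent_exp (hnil s), IsNilpotent.exp_eq_sum h,
          Finset.sum_range_succ', Finset.mul_sum]
        simp [pow_succ']
      · exact Commute.sum_right _ _ _ fun i _ =>
          ((Commute.refl (s • A)).pow_right i).smul_right _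
    rw [hC, hc.mul_pow, smul_pow, hA, smul_zero, zero_mul]
  have hcomm : ∀ s : ℂ, Commute A (exp (s • A)) := fun s =>
    ((Commute.refl A).smul_right s).exp_right
  have hd : ∀ (k : ℕ) (s : ℂ), HasDerivAt (fun s : ℂ => (exp (s • A) - 1) ^ (k + 1))
      (((k : ℂ) + 1) • ((exp (s • A) - 1) ^ k * (exp (s • A) * A))) s := by
    intro k s
    have h0 := (hasDerivAt_matrix_exp A s).sub_const 1
    induction k with
    | zero =>
      convert! h0 using 1
      · simp
      · simp
    | succ k ih =>
      have h1 := ih.mul h0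
      simp_rw [pow_succ _ (k + 1)]
      convert! h1 using 1
      have hc : Commute (exp (s • A) * A) (exp (s • A) - 1) :=
        ((Commute.refl _).mul_left (hcomm s)).sub_right (Commute.one_right _)
      rw [smul_mul_assoc, mul_assoc ((exp (s • A) - 1) ^ k), hc.eq,
        ← mul_assoc ((exp (s • A) - 1) ^ k), ← pow_succ]
      push_cast
      rw [add_smul, one_smul]
  have hlog : ∀ s : ℂ, HasDerivAt (fun s : ℂ => unipotentLog (exp (s • A)) - s • A) 0 s := by
    intro s
    have h1 : HasDerivAt (fun s : ℂ => unipotentLog (exp (s • A)))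
        (∑ k ∈ Finset.range N, ((-1 : ℂ) ^ k / (k + 1)) •
          (((k : ℂ) + 1) • ((exp (s • A) - 1) ^ k * (exp (s • A) * A)))) s :=
      HasDerivAt.fun_sum fun k _ => (hd k s).fun_const_smul _
    have h2 : HasDerivAt (fun s : ℂ => s • A) A s := by
      simpa using! (hasDerivAt_id s).smul_const A
    convert! h1.sub h2 using 1
    have h3 : ∀ k ∈ Finset.range N, ((-1 : ℂ) ^ k / (k + 1)) •
        (((k : ℂ) + 1) • ((exp (s • A) - 1) ^ k * (exp (s • A) * A))) =
        (-(exp (s • A) - 1)) ^ k * (exp (s • A) * A) := by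
      intro k _
      have : (k : ℂ) + 1 ≠ 0 := by exact_mod_cast k.succ_ne_zero
      rw [smul_smul, div_mul_cancel₀ _ this, ← neg_one_smul ℂ (exp (s • A) - 1), smul_pow,
        smul_mul_assoc]
    rw [Finset.sum_congr rfl h3, ← Finset.sum_mul]
    have h5 : (∑ i ∈ Finset.range N, (-(exp (s • A) - 1)) ^ i) * exp (s • A) = 1 := by
      have := geom_sum_mul_neg (-(exp (s • A) - 1)) N
      rw [neg_pow, hpow, mul_zero, sub_zero] at this
      have e : 1 - -(exp (s • A) - 1) = exp (s • A) := by simp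
      rwa [e] at this
    rw [← mul_assoc, h5, one_mul, sub_self]
  have hconst := is_const_of_deriv_eq_zero (fun s => (hlog s).differentiableAt)
    (fun s => (hlog s).deriv) 1 0
  have h0 : unipotentLog (exp ((0 : ℂ) • A)) = 0 := by
    simp [unipotentLog]
  simp only [one_smul] at hconst
  rw [h0, zero_smul, sub_zero] at hconst
  exact sub_eq_zero.1 hconst

theorem unipotentLog_conj {A C X : Matrix ι ι ℂ} (h : C * A = 1) :
    unipotentLog (A * X * C) = A * unipotentLog X * C := by
  have h' : A * C = 1 := mul_eq_one_comm.1 h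
  have hp : ∀ k : ℕ, (A * X * C - 1) ^ k = A * (X - 1) ^ k * C := by
    intro k
    induction k with
    | zero => simp [h']
    | succ k ih =>
      have e : A * X * C - 1 = A * (X - 1) * C := by
        rw [Matrix.mul_sub, Matrix.sub_mul, Matrix.mul_one, h']
      rw [pow_succ, ih, e, pow_succ]
      calc A * (X - 1) ^ k * C * (A * (X - 1) * C)
          = A * (X - 1) ^ k * (C * A) * (X - 1) * C := by simp only [Matrix.mul_assoc]
        _ = _ := by rw [h, Matrix.mul_one]; simp only [Matrix.mul_assoc]
  simp only [unipotentLog, hp, Matrix.mul_sum, Matrix.sum_mul, Matrix.mul_smul, Matrix.smul_mul]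

theorem exp_conj_of_mul_eq_one {A C : Matrix ι ι ℂ} (h : C * A = 1) (X : Matrix ι ι ℂ) :
    exp (A * X * C) = A * exp X * C := by
  have h' : A * C = 1 := mul_eq_one_comm.1 h
  rw [← Matrix.inv_eq_left_inv h]
  exact Matrix.exp_conj A X (IsUnit.of_mul_eq_one C h')

open scoped Norms.Operator in
/-- A solution of `F' = A F` is `exp (w A) F(0)`. -/
theorem eq_exp_mul_of_hasDerivAt {A : Matrix ι ι ℂ} {F : ℂ → Matrix ι ι ℂ}
    (hF : ∀ w, HasDerivAt F (A * F w) w) (w : ℂ) : F w = exp (w • A) * F 0 := by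
  have h1 : ∀ w, HasDerivAt (fun w : ℂ => exp (w • (-A)) * F w) 0 w := by
    intro w
    convert! (hasDerivAt_matrix_exp (-A) w).mul (hF w) using 1
    simp [mul_assoc]
  have h2 := is_const_of_deriv_eq_zero (fun s => (h1 s).differentiableAt)
    (fun s => (h1 s).deriv) w 0
  simp only [zero_smul, exp_zero, one_mul] at h2
  rw [← h2, ← mul_assoc, smul_neg, ← Matrix.exp_add_of_commute _ _ (Commute.refl (w • A)).neg_right,
    add_neg_cancel, exp_zero, one_mul]

end Exp

/-! ### Matrices of polylogarithmic shape -/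

section PolyMat

variable (n : ℕ)

theorem two_pi_I_ne_zero : (2 * Real.pi * Complex.I : ℂ) ≠ 0 := Complex.two_pi_I_ne_zero

/-- The matrix of polylogarithms, with `lam k` for `ln_k x` and `l` for `log x`. -/
def polyMat (lam : ℕ → ℂ) (l : ℂ) : Matrix (Fin (n + 1)) (Fin (n + 1)) ℂ :=
  Matrix.of fun j k =>
    if (k : ℕ) < j then 0
    else if (j : ℕ) = 0 then (if (k : ℕ) = 0 then 1 else lam k)
    else (2 * Real.pi * Complex.I) ^ (j : ℕ) / (Nat.factorial (k - j : ℕ) : ℂ) *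
      l ^ (k - j : ℕ)

variable {n}

theorem polylogMatrix_eq (x : ℂ) :
    polylogMatrix n x = polyMat n (fun k => lnSeries k x) (Complex.log x) := rfl

theorem polyMat_congr {lam lam' : ℕ → ℂ} (h : ∀ k, lam (k + 1) = lam' (k + 1)) (l : ℂ) :
    polyMat n lam l = polyMat n lam' l := by
  ext j k
  simp only [polyMat, Matrix.of_apply]
  split_ifs with h1 h2 h3
  · rfl
  · rfl
  · obtain ⟨m, hm⟩ := Nat.exists_eq_succ_of_ne_zero h3
    rw [hm]
    exact h m
  · rfl

theorem isUnit_det_polyMat (lam : ℕ → ℂ) (l : ℂ) : IsUnit (polyMat n lam l).det := by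
  rw [Matrix.det_of_isUpperTriangular, isUnit_iff_ne_zero, Finset.prod_ne_zero_iff]
  · intro j _
    simp only [polyMat, Matrix.of_apply, lt_irrefl, if_false]
    split_ifs
    · exact one_ne_zero
    · simp
  · intro j k hjk
    simp only [polyMat, Matrix.of_apply]
    rw [if_pos (by simpa using hjk)]

/-- `2πi` times the residue at `0` in the frame given by the rows of the polylogarithm matrix. -/
def monLogZero (n : ℕ) : Matrix (Fin (n + 1)) (Fin (n + 1)) ℚ :=
  Matrix.of fun j k => if (k : ℕ) = j + 1 ∧ (j : ℕ) ≠ 0 then 1 else 0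

/-- `2πi` times the residue at `1` in the frame given by the rows of the polylogarithm matrix. -/
def monLogOne (n : ℕ) : Matrix (Fin (n + 1)) (Fin (n + 1)) ℚ :=
  Matrix.of fun j k => if (k : ℕ) = j + 1 ∧ (j : ℕ) = 0 then -1 else 0

theorem ratMat_pow_eq_zero {J : Matrix (Fin (n + 1)) (Fin (n + 1)) ℚ}
    (h : ∀ j k : Fin (n + 1), (k : ℕ) ≠ j + 1 → J j k = 0) : (ratMat J) ^ (n + 1) = 0 := by
  ext j k
  refine strictUpper_pow (fun i j hij => ?_) (n + 1) j k (by omega)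
  simp [h i j (by omega)]

theorem isNilpotent_of_superdiagonal {J : Matrix (Fin (n + 1)) (Fin (n + 1)) ℚ}
    (h : ∀ j k : Fin (n + 1), (k : ℕ) ≠ j + 1 → J j k = 0) : IsNilpotent J := by
  refine ⟨n + 1, ratMat_injective ?_⟩
  have := map_pow ((Rat.castHom ℂ).mapMatrix (m := Fin (n + 1))) J (n + 1)
  refine this.trans ((ratMat_pow_eq_zero h).trans ?_)
  ext
  simp

theorem monLogZero_apply (j k : Fin (n + 1)) (h : (k : ℕ) ≠ j + 1) : monLogZero n j k = 0 := by
  simp [monLogZero, h]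

theorem monLogOne_apply (j k : Fin (n + 1)) (h : (k : ℕ) ≠ j + 1) : monLogOne n j k = 0 := by
  simp [monLogOne, h]

theorem superdiagonal_mul_apply {J M : Matrix (Fin (n + 1)) (Fin (n + 1)) ℂ}
    (h : ∀ j k : Fin (n + 1), (k : ℕ) ≠ j + 1 → J j k = 0) (j k : Fin (n + 1)) :
    (J * M) j k = if hj : (j : ℕ) + 1 < n + 1 then J j ⟨j + 1, hj⟩ * M ⟨j + 1, hj⟩ k else 0 := by
  rw [Matrix.mul_apply]
  split_ifs with hj
  · refine Finset.sum_eq_single _ (fun i _ hi => ?_) (by simp)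
    rw [h j i (fun e => hi (Fin.ext e)), zero_mul]
  · refine Finset.sum_eq_zero fun i _ => ?_
    rw [h j i (by omega), zero_mul]

theorem hasDerivAt_matrix_of_entries {F : ℂ → Matrix (Fin (n + 1)) (Fin (n + 1)) ℂ}
    {F' : Matrix (Fin (n + 1)) (Fin (n + 1)) ℂ} {w : ℂ}
    (h : ∀ j k, HasDerivAt (fun w => F w j k) (F' j k) w) : HasDerivAt F F' w :=
  hasDerivAt_pi.2 fun j => hasDerivAt_pi.2 fun k => h j k

theorem hasDerivAt_const_of_eq_zero (c u : ℂ) {d : ℂ} (h : d = 0) :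
    HasDerivAt (fun _ => c) d u := h ▸ hasDerivAt_const u c

/-- For `j ≥ 1` the derivative of row `j` in the logarithm is row `j + 1` divided by `2πi`, and row
`0` does not involve `l`. So both sides solve the same linear equation in `w`. -/
theorem polyMat_add (lam : ℕ → ℂ) (l w : ℂ) :
    polyMat n lam (l + w) = NormedSpace.exp
      (w • ((2 * Real.pi * Complex.I : ℂ)⁻¹ • ratMat (monLogZero n))) * polyMat n lam l := by
  have := eq_exp_mul_of_hasDerivAt (F := fun w => polyMat n lam (l + w))
    (A := (2 * Real.pi * Complex.I : ℂ)⁻¹ • ratMat (monLogZero n)) (fun w => ?_) w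
  · simpa using this
  refine hasDerivAt_matrix_of_entries fun j k => ?_
  rw [Matrix.smul_mul, Matrix.smul_apply, superdiagonal_mul_apply
    (fun j k h => by simp [monLogZero_apply j k h])]
  simp only [polyMat, Matrix.of_apply, monLogZero, Matrix.map_apply]
  rcases lt_trichotomy (k : ℕ) j with h | h | h
  · simp_rw [if_pos h]
    convert! hasDerivAt_const w (0 : ℂ) using 1
    split_ifs <;> first | omega | simp
  · simp_rw [if_neg (show ¬ (k : ℕ) < j by omega)]
    simp_rw [show (k : ℕ) - j = 0 by omega, pow_zero]
    refine hasDerivAt_const_of_eq_zero _ _ ?_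
    split_ifs <;> first | omega | simp
  · simp_rw [if_neg (show ¬ (k : ℕ) < j by omega)]
    by_cases hj : (j : ℕ) = 0
    · simp_rw [if_pos hj]
      refine hasDerivAt_const_of_eq_zero _ _ ?_
      simp [hj]
    · simp_rw [if_neg hj]
      obtain ⟨m, hm⟩ := Nat.exists_eq_add_of_lt h
      have e1 : (k : ℕ) - j = m + 1 := by omega
      have e2 : (k : ℕ) - (j + 1) = m := by omega
      rw [dif_pos (by omega)]
      simp only [ne_eq, hj, not_false_eq_true, and_self, if_true,
        show ¬ (k : ℕ) < j + 1 by omega, if_false, Nat.add_eq_zero_iff, one_ne_zero, e1, e2, Rat.cast_one]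
      have hl : HasDerivAt (fun w : ℂ => l + w) 1 w := (hasDerivAt_id w).const_add l
      convert! (hasDerivAt_pow_div_factorial hl m).const_mul
        ((2 * Real.pi * Complex.I : ℂ) ^ (j : ℕ)) using 1
      · ext w; ring
      · have := two_pi_I_ne_zero
        rw [pow_succ]
        simp only [smul_eq_mul]
        field_simp

/-- Row `1` divided by `2πi` has the entries `l ^ (k - 1) / (k - 1)!` for `k ≥ 1`, and `w` times it
is subtracted from row `0`. The truncated `k - 1` at `k = 0` is harmless, since `lam 0` is never
used. -/
theorem polyMat_sub (lam : ℕ → ℂ) (l w : ℂ) :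
    polyMat n (fun k => lam k - w * (l ^ (k - 1) / (k - 1).factorial)) l = NormedSpace.exp
      (w • ((2 * Real.pi * Complex.I : ℂ)⁻¹ • ratMat (monLogOne n))) * polyMat n lam l := by
  have := eq_exp_mul_of_hasDerivAt
    (F := fun w => polyMat n (fun k => lam k - w * (l ^ (k - 1) / (k - 1).factorial)) l)
    (A := (2 * Real.pi * Complex.I : ℂ)⁻¹ • ratMat (monLogOne n)) (fun w => ?_) w
  · simpa using this
  refine hasDerivAt_matrix_of_entries fun j k => ?_
  rw [Matrix.smul_mul, Matrix.smul_apply, superdiagonal_mul_apply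
    (fun j k h => by simp [monLogOne_apply j k h])]
  simp only [polyMat, Matrix.of_apply, monLogOne, Matrix.map_apply]
  by_cases hj : (j : ℕ) = 0
  · simp_rw [if_neg (show ¬ (k : ℕ) < j by omega), if_pos hj]
    by_cases hk : (k : ℕ) = 0
    · simp_rw [if_pos hk]
      convert! hasDerivAt_const w (1 : ℂ) using 1
      split_ifs <;> first | omega | simp
    · simp_rw [if_neg hk]
      rw [dif_pos (by omega)]
      simp only [hj, and_self, if_true, zero_add, show ¬ (k : ℕ) < 1 by omega, if_false,
        one_ne_zero, pow_one]
      convert! ((hasDerivAt_id w).mul_const _).const_sub (lam k) using 1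
      have := two_pi_I_ne_zero
      simp only [Rat.cast_neg, Rat.cast_one, smul_eq_mul]
      field_simp
  · simp_rw [if_neg hj]
    refine hasDerivAt_const_of_eq_zero _ _ ?_
    simp [hj]

/-! ### Flat sections -/

theorem vecMul_polylogConn_zero (v : Fin (n + 1) → ℂ) (z : ℂ) : (v ᵥ* polylogConn n z) 0 = 0 := by
  rw [Matrix.vecMul, dotProduct]
  exact Finset.sum_eq_zero fun i _ => by simp [polylogConn]

theorem vecMul_polylogConn_succ (v : Fin (n + 1) → ℂ) (z : ℂ) (i : Fin n) :
    (v ᵥ* polylogConn n z) i.succ =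
      v i.castSucc * (if (i : ℕ) = 0 then 1 / (1 - z) else 1 / z) := by
  rw [Matrix.vecMul, dotProduct, Finset.sum_eq_single i.castSucc]
  · simp only [polylogConn, Matrix.of_apply, Fin.val_succ, Fin.val_castSucc, if_true]
  · intro j _ hj
    have : ¬ (i : ℕ) = j := fun e => hj (Fin.ext (by simp [e]))
    simp [polylogConn, this]
  · simp

/-- Each column is a primitive of the preceding one. Working along a parametrisation `u ↦ z u` lets
the logarithm be a function of `u`, as is needed on the universal cover of a punctured disk. -/
theorem hasDerivAt_polyMat {lam : ℕ → ℂ → ℂ} {l z : ℂ → ℂ} {z' u : ℂ}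
    (hl : HasDerivAt l (z' / z u) u) (h1 : HasDerivAt (lam 1) (z' / (1 - z u)) u)
    (h2 : ∀ k, HasDerivAt (lam (k + 2)) (lam (k + 1) u * (z' / z u)) u) (j : Fin (n + 1)) :
    HasDerivAt (fun u => polyMat n (fun k => lam k u) (l u) j)
      (z' • (polyMat n (fun k => lam k u) (l u) j ᵥ* polylogConn n (z u))) u := by
  refine hasDerivAt_pi.2 fun k => ?_
  rw [Pi.smul_apply]
  refine Fin.cases ?_ (fun i => ?_) k
  · rw [vecMul_polylogConn_zero, smul_zero]
    convert! hasDerivAt_const u (polyMat n (fun k => lam k u) (l u) j 0) using 1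
    ext w
    simp only [polyMat, Matrix.of_apply]
    simp
  · rw [vecMul_polylogConn_succ]
    simp only [polyMat, Matrix.of_apply, Fin.val_succ, Fin.val_castSucc]
    by_cases hj : (j : ℕ) = 0
    · simp only [hj, not_lt_zero, if_false, if_true, Nat.add_eq_zero_iff, one_ne_zero, and_false]
      by_cases hi : (i : ℕ) = 0
      · simp only [hi, zero_add, if_true]
        convert! h1 using 1
        simp [div_eq_mul_inv]
      · obtain ⟨m, hm⟩ := Nat.exists_eq_succ_of_ne_zero hi
        simp only [hm, Nat.succ_eq_add_one, Nat.add_eq_zero_iff, one_ne_zero, and_false, if_false]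
        convert! h2 m using 1
        simp only [smul_eq_mul]
        ring
    · simp only [hj, if_false]
      rcases lt_trichotomy ((i : ℕ) + 1) j with h | h | h
      · simp only [h, if_true, show (i : ℕ) < j by omega]
        convert! hasDerivAt_const u (0 : ℂ) using 1
        simp
      · simp only [h, lt_irrefl, if_false, Nat.sub_self, pow_zero, show (i : ℕ) < j by omega,
          if_true]
        refine hasDerivAt_const_of_eq_zero _ _ ?_
        simp
      · obtain ⟨m, hm⟩ := Nat.exists_eq_add_of_lt h
        simp only [show ¬ (i : ℕ) + 1 < j by omega, show ¬ (i : ℕ) < j by omega, if_false,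
          show (i : ℕ) + 1 - j = m + 1 by omega, show (i : ℕ) - j = m by omega,
          show ¬ (i : ℕ) = 0 by omega]
        convert! (hasDerivAt_pow_div_factorial hl m).const_mul
          ((2 * Real.pi * Complex.I : ℂ) ^ (j : ℕ)) using 1
        · ext w; ring
        · simp only [smul_eq_mul]; ring

/-- The connection is strictly triangular: the derivative of each component is a multiple of the
preceding component. So the components vanish one after the other. -/
theorem flat_eq_zero {s : Set ℂ} (hs : Convex ℝ s) {g : ℂ → Fin (n + 1) → ℂ} {c z : ℂ → ℂ}
    (hg : ∀ u ∈ s, HasDerivAt g (c u • (g u ᵥ* polylogConn n (z u))) u) {u₀ : ℂ} (h₀ : u₀ ∈ s)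
    (hg₀ : g u₀ = 0) : ∀ u ∈ s, g u = 0 := by
  have hconst : ∀ k, (∀ u ∈ s, HasDerivAt (fun u => g u k) 0 u) → ∀ u ∈ s, g u k = 0 := by
    intro k hk u hu
    have := hs.norm_image_sub_le_of_norm_hasDerivWithin_le (f := fun u => g u k) (C := 0)
      (fun u hu => (hk u hu).hasDerivWithinAt) (fun u _ => by simp) h₀ hu
    rw [zero_mul, norm_le_zero_iff, hg₀] at this
    simpa using this
  have hk : ∀ k, ∀ u ∈ s, g u k = 0 := by
    intro k
    refine Fin.induction ?_ (fun i ih => ?_) k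
    · refine hconst 0 fun u hu => ?_
      have := hasDerivAt_pi.1 (hg u hu) 0
      rwa [Pi.smul_apply, vecMul_polylogConn_zero, smul_zero] at this
    · refine hconst _ fun u hu => ?_
      have := hasDerivAt_pi.1 (hg u hu) i.succ
      rwa [Pi.smul_apply, vecMul_polylogConn_succ, ih u hu, zero_mul, smul_zero] at this
  intro u hu
  ext k
  exact hk k u hu

theorem hasDerivAt_vecMul_frame {B : ℂ → Matrix (Fin (n + 1)) (Fin (n + 1)) ℂ} {c z u : ℂ}
    (hB : ∀ j, HasDerivAt (fun u => B u j) (c • (B u j ᵥ* polylogConn n z)) u)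
    (a : Fin (n + 1) → ℂ) :
    HasDerivAt (fun u => a ᵥ* B u) (c • ((a ᵥ* B u) ᵥ* polylogConn n z)) u := by
  simp_rw [Matrix.vecMul_eq_sum a]
  convert! HasDerivAt.fun_sum fun i (_ : i ∈ Finset.univ) => (hB i).fun_const_smul (a i) using 1
  rw [← Matrix.vecMul_eq_sum]
  rw [Matrix.vecMul_vecMul, Matrix.vecMul_eq_sum, Finset.smul_sum]
  refine Finset.sum_congr rfl fun i _ => ?_
  rw [smul_comm]
  rfl

/-- A flat section is a constant combination of the rows of a flat frame. -/
theorem flat_eq_vecMul {s : Set ℂ} (hs : Convex ℝ s)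
    {B : ℂ → Matrix (Fin (n + 1)) (Fin (n + 1)) ℂ} {g : ℂ → Fin (n + 1) → ℂ} {c z : ℂ → ℂ}
    (hB : ∀ u ∈ s, ∀ j, HasDerivAt (fun u => B u j) (c u • (B u j ᵥ* polylogConn n (z u))) u)
    (hg : ∀ u ∈ s, HasDerivAt g (c u • (g u ᵥ* polylogConn n (z u))) u) {u₀ : ℂ} (h₀ : u₀ ∈ s)
    (hdet : IsUnit (B u₀).det) :
    ∀ u ∈ s, g u = (g u₀ ᵥ* (B u₀)⁻¹) ᵥ* B u := by
  intro u hu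
  refine sub_eq_zero.1 (flat_eq_zero hs (g := fun u => g u - (g u₀ ᵥ* (B u₀)⁻¹) ᵥ* B u)
    (c := c) (z := z) (fun u hu => ?_) h₀ ?_ u hu)
  · convert! (hg u hu).sub (hasDerivAt_vecMul_frame (hB u hu) (g u₀ ᵥ* (B u₀)⁻¹)) using 1
    rw [Matrix.sub_vecMul, smul_sub]
  · rw [Matrix.vecMul_vecMul, Matrix.nonsing_inv_mul _ hdet, Matrix.vecMul_one, sub_self]

theorem flat_eq_mul {s : Set ℂ} (hs : Convex ℝ s)
    {B Y : ℂ → Matrix (Fin (n + 1)) (Fin (n + 1)) ℂ} {c z : ℂ → ℂ}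
    (hB : ∀ u ∈ s, ∀ j, HasDerivAt (fun u => B u j) (c u • (B u j ᵥ* polylogConn n (z u))) u)
    (hY : ∀ u ∈ s, ∀ j, HasDerivAt (fun u => Y u j) (c u • (Y u j ᵥ* polylogConn n (z u))) u)
    {u₀ : ℂ} (h₀ : u₀ ∈ s) (hdet : IsUnit (B u₀).det) :
    ∃ A, ∀ u ∈ s, Y u = A * B u := by
  refine ⟨Y u₀ * (B u₀)⁻¹, fun u hu => ?_⟩
  ext j k
  exact congrFun (flat_eq_vecMul hs hB (fun u hu => hY u hu j) h₀ hdet u hu) k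

end PolyMat

/-! ### The branches of the polylogarithm matrix -/

section Branches

variable (n : ℕ)

/-- The branch of the polylogarithm matrix at `z ∉ [1, ∞)` for the value `l` of `log z`. -/
def branchZero (z l : ℂ) : Matrix (Fin (n + 1)) (Fin (n + 1)) ℂ :=
  polyMat n (fun k => polylog k z) l

/-- The branch of the polylogarithm matrix at `z ∉ (-∞, 0]` for the value `l` of
`log (1 - z)`. -/
def branchOne (z l : ℂ) : Matrix (Fin (n + 1)) (Fin (n + 1)) ℂ :=
  polyMat n (fun k => polylogReg k z - l * (Complex.log z ^ (k - 1) / (k - 1).factorial))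
    (Complex.log z)

open scoped Classical in
/-- The rational span of the rows of any branch at `z` of the polylogarithm matrix. -/
def branchSpan (z : ℂ) : Submodule ℚ (Fin (n + 1) → ℂ) :=
  if z ∈ cutPlane then ratRows (branchZero n z (Complex.log z))
  else ratRows (branchOne n z (Complex.log (1 - z)))

variable {n}

theorem branchZero_eq_branchOne {z : ℂ} (h0 : z ∈ Complex.slitPlane) (h1 : z ∈ cutPlane) :
    branchZero n z (Complex.log z) = branchOne n z (Complex.log (1 - z)) :=
  polyMat_congr (fun k => polylog_eq_polylogReg k h0 h1) _

theorem branchZero_add (z l w : ℂ) :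
    branchZero n z (l + w) = NormedSpace.exp
      (w • ((2 * Real.pi * Complex.I : ℂ)⁻¹ • ratMat (monLogZero n))) * branchZero n z l :=
  polyMat_add _ _ _

theorem branchOne_add (z l w : ℂ) :
    branchOne n z (l + w) = NormedSpace.exp
      (w • ((2 * Real.pi * Complex.I : ℂ)⁻¹ • ratMat (monLogOne n))) * branchOne n z l := by
  rw [branchOne, branchOne, ← polyMat_sub]
  refine polyMat_congr (fun k => ?_) _
  ring

theorem isNilpotent_monLogZero : IsNilpotent (monLogZero n) :=
  isNilpotent_of_superdiagonal monLogZero_apply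

theorem isNilpotent_monLogOne : IsNilpotent (monLogOne n) :=
  isNilpotent_of_superdiagonal monLogOne_apply

/-- The factor `2πi m` cancels the denominator `2πi`, leaving the exponential of the rational matrix
`m J`. Hence the rational span does not depend on the branch of the logarithm. -/
theorem ratRows_exp_int_mul {J : Matrix (Fin (n + 1)) (Fin (n + 1)) ℚ} (h : IsNilpotent J) (m : ℤ)
    (M : Matrix (Fin (n + 1)) (Fin (n + 1)) ℂ) :
    ratRows (NormedSpace.exp
      ((m * (2 * Real.pi * Complex.I) : ℂ) • ((2 * Real.pi * Complex.I : ℂ)⁻¹ • ratMat J)) * M) =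
      ratRows M := by
  have e : (m * (2 * Real.pi * Complex.I) : ℂ) • ((2 * Real.pi * Complex.I : ℂ)⁻¹ • ratMat J) =
      ratMat ((m : ℚ) • J) := by
    rw [smul_smul, mul_assoc, mul_inv_cancel₀ two_pi_I_ne_zero, mul_one]
    ext i j
    simp
  rw [e]
  exact ratRows_exp_mul (h.smul _) M

theorem branchSpan_eq_zero {z l : ℂ} (hz : z ∈ cutPlane) (hl : Complex.exp l = z) :
    branchSpan n z = ratRows (branchZero n z l) := by
  have h0 : z ≠ 0 := hl ▸ Complex.exp_ne_zero l
  rw [branchSpan, if_pos hz]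
  obtain ⟨m, hm⟩ := Complex.exp_eq_exp_iff_exists_int.1 (hl.trans (Complex.exp_log h0).symm)
  rw [hm, branchZero_add, ratRows_exp_int_mul isNilpotent_monLogZero]

theorem branchSpan_eq_one {z l : ℂ} (hz : z ∈ Complex.slitPlane) (hl : Complex.exp l = 1 - z) :
    branchSpan n z = ratRows (branchOne n z l) := by
  have h0 : 1 - z ≠ 0 := hl ▸ Complex.exp_ne_zero l
  obtain ⟨m, hm⟩ := Complex.exp_eq_exp_iff_exists_int.1 (hl.trans (Complex.exp_log h0).symm)
  rw [hm, branchOne_add, ratRows_exp_int_mul isNilpotent_monLogOne, branchSpan]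
  split_ifs with h
  · rw [branchZero_eq_branchOne hz h]
  · rfl

theorem isUnit_det_branchZero (z l : ℂ) : IsUnit (branchZero n z l).det := isUnit_det_polyMat _ _

theorem isUnit_det_branchOne (z l : ℂ) : IsUnit (branchOne n z l).det := isUnit_det_polyMat _ _

theorem hasDerivAt_branchZero {z l : ℂ → ℂ} {z' u : ℂ} (hz : HasDerivAt z z' u)
    (hl : HasDerivAt l (z' / z u) u) (h0 : z u ≠ 0) (h1 : z u ∈ cutPlane) (j : Fin (n + 1)) :
    HasDerivAt (fun u => branchZero n (z u) (l u) j)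
      (z' • (branchZero n (z u) (l u) j ᵥ* polylogConn n (z u))) u := by
  refine hasDerivAt_polyMat (lam := fun k u => polylog k (z u)) hl ?_ (fun k => ?_) j
  · convert! (hasDerivAt_polylog_one h1).comp u hz using 1
    ring
  · convert! (hasDerivAt_polylog (k := k) h1 h0).comp u hz using 1
    ring

theorem hasDerivAt_branchOne {z l : ℂ → ℂ} {z' u : ℂ} (hz : HasDerivAt z z' u)
    (hl : HasDerivAt l (-z' / (1 - z u)) u) (h0 : z u ∈ Complex.slitPlane) (h1 : z u ≠ 1)
    (j : Fin (n + 1)) :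
    HasDerivAt (fun u => branchOne n (z u) (l u) j)
      (z' • (branchOne n (z u) (l u) j ᵥ* polylogConn n (z u))) u := by
  have hlog : HasDerivAt (fun u => Complex.log (z u)) (z' / z u) u := hz.clog h0
  refine hasDerivAt_polyMat (lam := fun k u => polylogReg k (z u) -
    l u * (Complex.log (z u) ^ (k - 1) / (k - 1).factorial)) hlog ?_ (fun k => ?_) j
  · convert! hl.neg using 1
    · ext u; simp [polylogReg]
    · ring
  · convert! ((hasDerivAt_polylogReg (k := k) h0 h1).comp u hz).sub
      (hl.mul (hasDerivAt_pow_div_factorial hlog k)) using 1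
    have h3 : 1 - z u ≠ 0 := sub_ne_zero.2 h1.symm
    have h4 : ((k + 1).factorial : ℂ) ≠ 0 := by exact_mod_cast (k + 1).factorial_ne_zero
    have h5 : (k.factorial : ℂ) ≠ 0 := by exact_mod_cast k.factorial_ne_zero
    have h6 := Complex.slitPlane_ne_zero h0
    simp only [Nat.add_sub_cancel]
    field_simp
    ring

/-- Near every point outside `{0, 1}` there is a flat frame of which the rational span of the rows
is `branchSpan`. -/
theorem exists_flat_frame {x : ℂ} (h0 : x ≠ 0) (h1 : x ≠ 1) :
    ∃ r > 0, ∃ B : ℂ → Matrix (Fin (n + 1)) (Fin (n + 1)) ℂ, ∀ y ∈ Metric.ball x r,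
      y ≠ 0 ∧ y ≠ 1 ∧ IsUnit (B y).det ∧ branchSpan n y = ratRows (B y) ∧
      ∀ j, HasDerivAt (fun y => B y j) (B y j ᵥ* polylogConn n y) y := by
  by_cases hx : x ∈ cutPlane
  · have hev : ∀ᶠ y in 𝓝 x, y ≠ 0 ∧ y ∈ cutPlane ∧ y / x ∈ Complex.slitPlane := by
      have hc : ContinuousAt (fun y : ℂ => y / x) x := by fun_prop
      refine Filter.Eventually.and (isOpen_ne.mem_nhds h0) (Filter.Eventually.and (isOpen_cutPlane.mem_nhds hx)
        (hc.preimage_mem_nhds (Complex.isOpen_slitPlane.mem_nhds ?_)))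
      simp [div_self h0]
    obtain ⟨r, hr, H⟩ := Metric.eventually_nhds_iff_ball.1 hev
    -- `log (y / x) + log x` is a branch of the logarithm holomorphic near `x`, even when `x` lies
    -- on the negative axis.
    refine ⟨r, hr, fun y => branchZero n y (Complex.log (y / x) + Complex.log x), fun y hy => ?_⟩
    obtain ⟨hy0, hyc, hys⟩ := H y hy
    refine ⟨hy0, fun e => one_notMem_cutPlane (e ▸ hyc), isUnit_det_branchZero _ _,
      branchSpan_eq_zero hyc ?_, fun j => ?_⟩
    · rw [Complex.exp_add, Complex.exp_log (div_ne_zero hy0 h0), Complex.exp_log h0,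
        div_mul_cancel₀ _ h0]
    · have hl : HasDerivAt (fun y => Complex.log (y / x) + Complex.log x) (1 / y) y := by
        convert! (((hasDerivAt_id y).div_const x).clog hys).add_const (Complex.log x) using 1
        simp only [id]
        field_simp
      simpa using hasDerivAt_branchZero (hasDerivAt_id y) hl hy0 hyc j
  -- Outside `cutPlane` the real part of `x` is at least `1`, so the frame built from `log (1 - y)`
  -- is available.
  · have hxs : x ∈ Complex.slitPlane := by
      simp only [cutPlane, Set.mem_ofPred_eq, Complex.mem_slitPlane_iff, not_or] at hx
      rw [Complex.mem_slitPlane_iff]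
      left
      have := hx.1
      simp at this
      linarith
    have h1' : 1 - x ≠ 0 := sub_ne_zero.2 h1.symm
    have hev : ∀ᶠ y in 𝓝 x, y ≠ 1 ∧ y ∈ Complex.slitPlane ∧
        (1 - y) / (1 - x) ∈ Complex.slitPlane := by
      have hc : ContinuousAt (fun y : ℂ => (1 - y) / (1 - x)) x := by fun_prop
      refine Filter.Eventually.and (isOpen_ne.mem_nhds h1) (Filter.Eventually.and (Complex.isOpen_slitPlane.mem_nhds hxs)
        (hc.preimage_mem_nhds (Complex.isOpen_slitPlane.mem_nhds ?_)))
      simp [div_self h1']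
    obtain ⟨r, hr, H⟩ := Metric.eventually_nhds_iff_ball.1 hev
    refine ⟨r, hr, fun y => branchOne n y (Complex.log ((1 - y) / (1 - x)) + Complex.log (1 - x)),
      fun y hy => ?_⟩
    obtain ⟨hy1, hyc, hys⟩ := H y hy
    have hy1' : 1 - y ≠ 0 := sub_ne_zero.2 hy1.symm
    refine ⟨Complex.slitPlane_ne_zero hyc, hy1, isUnit_det_branchOne _ _,
      branchSpan_eq_one hyc ?_, fun j => ?_⟩
    · rw [Complex.exp_add, Complex.exp_log (div_ne_zero hy1' h1'), Complex.exp_log h1',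
        div_mul_cancel₀ _ h1']
    · have hl : HasDerivAt (fun y => Complex.log ((1 - y) / (1 - x)) + Complex.log (1 - x))
          (-1 / (1 - y)) y := by
        have h2 : HasDerivAt (fun y : ℂ => 1 - y) (-1) y := by
          simpa using (hasDerivAt_id y).const_sub 1
        convert! ((h2.div_const (1 - x)).clog hys).add_const (Complex.log (1 - x)) using 1
        field_simp
      simpa using hasDerivAt_branchOne (hasDerivAt_id y) hl hyc hy1 j

/-! ### The fibres of the polylogarithm local system -/

/-- `f` is flat near `x` with value in `branchSpan` at `x`. -/
def IsRationalFlatAt (n : ℕ) (f : ℂ → Fin (n + 1) → ℂ) (x : ℂ) : Prop :=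
  (∀ᶠ y in 𝓝 x, HasDerivAt f (f y ᵥ* polylogConn n y) y) ∧ f x ∈ branchSpan n x

theorem IsRationalFlatAt.congr {f g : ℂ → Fin (n + 1) → ℂ} {x : ℂ} (h : f =ᶠ[𝓝 x] g)
    (hf : IsRationalFlatAt n f x) : IsRationalFlatAt n g x := by
  refine ⟨?_, h.self_of_nhds ▸ hf.2⟩
  filter_upwards [hf.1, h.eventuallyEq_nhds] with y hy hy'
  rw [← hy'.self_of_nhds]
  exact hy.congr_of_eventuallyEq hy'.symm

/-- If `f` is flat and rational at one point of a small ball, it is there a rational combination of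
the rows of a flat frame. By the identity theorem this combination represents `f` on the whole ball.
-/
theorem eventually_isRationalFlatAt_iff {f : ℂ → Fin (n + 1) → ℂ} {x : ℂ} (h0 : x ≠ 0)
    (h1 : x ≠ 1) (hf : AnalyticAt ℂ f x) :
    ∀ᶠ y in 𝓝 x, (IsRationalFlatAt n f y ↔ IsRationalFlatAt n f x) := by
  obtain ⟨r, hr, B, hB⟩ := exists_flat_frame (n := n) h0 h1
  obtain ⟨r', hr', hfan⟩ := Metric.eventually_nhds_iff_ball.1 hf.eventually_analyticAt
  set ρ := min r r'
  have hρ : 0 < ρ := lt_min hr hr'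
  have hBρ := fun y (hy : y ∈ Metric.ball x ρ) => hB y (Metric.ball_subset_ball (min_le_left _ _) hy)
  have hfρ : AnalyticOnNhd ℂ f (Metric.ball x ρ) := fun y hy =>
    hfan y (Metric.ball_subset_ball (min_le_right _ _) hy)
  have key : ∀ y ∈ Metric.ball x ρ, IsRationalFlatAt n f y →
      ∀ y' ∈ Metric.ball x ρ, IsRationalFlatAt n f y' := by
    rintro y hy ⟨hflat, hmem⟩ y' hy'
    obtain ⟨ε, hε, hεb⟩ := Metric.eventually_nhds_iff_ball.1
      (hflat.and (Metric.isOpen_ball.mem_nhds hy))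
    have hyε : y ∈ Metric.ball y ε := Metric.mem_ball_self hε
    have hloc := flat_eq_vecMul (convex_ball y ε) (B := B) (g := f) (c := fun _ => 1)
      (z := id) (fun u hu j => by simpa using (hBρ u (hεb u hu).2).2.2.2.2 j)
      (fun u hu => by simpa using (hεb u hu).1) hyε (hBρ y hy).2.2.1
    set a := f y ᵥ* (B y)⁻¹
    have hflat' : ∀ u ∈ Metric.ball x ρ,
        HasDerivAt (fun u => a ᵥ* B u) ((a ᵥ* B u) ᵥ* polylogConn n u) u := fun u hu => by
      simpa using hasDerivAt_vecMul_frame (c := 1)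
        (fun j => by simpa using (hBρ u hu).2.2.2.2 j) a
    have hanal : AnalyticOnNhd ℂ (fun u => a ᵥ* B u) (Metric.ball x ρ) :=
      DifferentiableOn.analyticOnNhd
        (fun u hu => (hflat' u hu).differentiableAt.differentiableWithinAt) Metric.isOpen_ball
    have heq : Set.EqOn f (fun u => a ᵥ* B u) (Metric.ball x ρ) :=
      hfρ.eqOn_of_preconnected_of_eventuallyEq hanal (convex_ball x ρ).isPreconnected hy
        (by filter_upwards [Metric.isOpen_ball.mem_nhds hyε] with u hu using hloc u hu)
    obtain ⟨q, hq⟩ : ∃ q : Fin (n + 1) → ℚ, (fun i => (q i : ℂ)) = a := by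
      rw [(hBρ y hy).2.2.2.1] at hmem
      obtain ⟨q, hq⟩ := mem_ratRows.1 hmem
      refine ⟨q, ?_⟩
      change _ = f y ᵥ* (B y)⁻¹
      rw [← hq, Matrix.vecMul_vecMul, Matrix.mul_nonsing_inv _ (hBρ y hy).2.2.1, Matrix.vecMul_one]
    have hball := Metric.isOpen_ball.mem_nhds hy'
    refine IsRationalFlatAt.congr (f := fun u => a ᵥ* B u)
      (by filter_upwards [hball] with u hu using (heq hu).symm) ⟨?_, ?_⟩
    · filter_upwards [hball] with u hu using hflat' u hu
    · rw [(hBρ y' hy').2.2.2.1]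
      exact mem_ratRows.2 ⟨q, by rw [hq]⟩
  filter_upwards [Metric.ball_mem_nhds x hρ] with y hy
  exact ⟨fun h => key y hy h x (Metric.mem_ball_self hρ),
    fun h => key x (Metric.mem_ball_self hρ) h y hy⟩

theorem one_half_mem_slitPlane : (1 / 2 : ℂ) ∈ Complex.slitPlane := by
  have := Complex.ofReal_mem_slitPlane.2 (show (0 : ℝ) < 1 / 2 by norm_num)
  simpa using this

theorem one_half_mem_cutPlane : (1 / 2 : ℂ) ∈ cutPlane := by
  have := ofReal_mem_cutPlane (show (1 / 2 : ℝ) < 1 by norm_num)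
  simpa using this

theorem polylogMatrix_eventuallyEq :
    polylogMatrix n =ᶠ[𝓝 (1 / 2)] fun z => branchZero n z (Complex.log z) := by
  filter_upwards [Metric.isOpen_ball.mem_nhds
    (show (1 / 2 : ℂ) ∈ Metric.ball (0 : ℂ) 1 by simp; norm_num)] with z hz
  rw [polylogMatrix_eq]
  exact polyMat_congr (fun k => lnSeries_eq_polylog k hz) _

theorem mem_compl_zero_one {x : ℂ} : x ∈ ({0, 1}ᶜ : Set ℂ) ↔ x ≠ 0 ∧ x ≠ 1 := by
  simp

/-- Along a continuation, the parameters at which the germ is flat and rational form a clopen subset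
of the unit interval; it contains `0`, hence also `1`. -/
theorem polylogFib_le_branchSpan (x : ℂ) : polylogFib n x ≤ branchSpan n x := by
  refine Submodule.span_le.2 ?_
  rintro y ⟨j, γ, c, hc, rfl⟩
  have hopen : ∀ t₀, ∀ᶠ s in 𝓝 t₀,
      (IsRationalFlatAt n (c s) (γ s) ↔ IsRationalFlatAt n (c t₀) (γ t₀)) := by
    intro t₀
    have hm := mem_compl_zero_one.1 (hc.mem t₀)
    filter_upwards [γ.continuous.continuousAt.eventually
      (eventually_isRationalFlatAt_iff hm.1 hm.2 (hc.analytic t₀)), hc.compatible t₀] with s h1 h2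
    rw [← h1]
    exact ⟨fun h => h.congr h2, fun h => h.congr h2.symm⟩
  have hclopen : IsClopen {t | IsRationalFlatAt n (c t) (γ t)} := by
    constructor
    · rw [← isOpen_compl_iff, isOpen_iff_mem_nhds]
      intro t ht
      filter_upwards [hopen t] with s hs using fun h => ht (hs.1 h)
    · rw [isOpen_iff_mem_nhds]
      intro t ht
      filter_upwards [hopen t] with s hs using hs.2 ht
  have h0 : (0 : unitInterval) ∈ {t | IsRationalFlatAt n (c t) (γ t)} := by
    change IsRationalFlatAt n (c 0) (γ 0)
    rw [γ.source]
    refine IsRationalFlatAt.congr hc.start.symm (IsRationalFlatAt.congr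
      (f := fun z => branchZero n z (Complex.log z) j) ?_ ⟨?_, ?_⟩)
    · filter_upwards [polylogMatrix_eventuallyEq (n := n)] with z hz
      rw [← hz]
    · filter_upwards [Complex.isOpen_slitPlane.mem_nhds one_half_mem_slitPlane,
        isOpen_cutPlane.mem_nhds one_half_mem_cutPlane] with z h1 h2
      simpa using hasDerivAt_branchZero (hasDerivAt_id z)
        (by simpa using Complex.hasDerivAt_log h1) (Complex.slitPlane_ne_zero h1) h2 j
    · rw [branchSpan, if_pos one_half_mem_cutPlane]
      exact Submodule.subset_span ⟨j, rfl⟩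
  have h1 : (1 : unitInterval) ∈ {t | IsRationalFlatAt n (c t) (γ t)} := by
    rw [hclopen.eq_univ ⟨0, h0⟩]
    trivial
  have := h1.2
  rwa [γ.target] at this

end Branches

/-! ### Reaching every point by an explicit continuation -/

section Fibres

variable {n : ℕ}

/-- A holomorphic matrix function on a connected set is a continuation of the polylogarithm
matrix if it is one near `1 / 2`. -/
theorem ratRows_le_polylogFib {V : Set ℂ} {x : ℂ} (hx : JoinedIn V (1 / 2) x)
    (hV : ∀ z ∈ V, z ≠ 0 ∧ z ≠ 1) {B : ℂ → Matrix (Fin (n + 1)) (Fin (n + 1)) ℂ}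
    (hB : ∀ y ∈ V, ∃ U ∈ 𝓝 y, ∀ z ∈ U, ∀ j, DifferentiableAt ℂ (fun z => B z j) z)
    (h0 : ∀ᶠ z in 𝓝 (1 / 2), B z = branchZero n z (Complex.log z)) :
    ratRows (B x) ≤ polylogFib n x := by
  refine Submodule.span_le.2 ?_
  rintro _ ⟨j, rfl⟩
  -- One function `B` is holomorphic near the whole path, so all germs of the continuation can be
  -- taken to be `B` itself.
  refine Submodule.subset_span ⟨j, hx.somePath, fun _ z => B z j,
    ⟨fun t => mem_compl_zero_one.2 (hV _ (hx.somePath_mem t)), ?_, fun t => ?_,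
      fun t => Eventually.of_forall fun s => EventuallyEq.rfl⟩, rfl⟩
  · filter_upwards [h0, polylogMatrix_eventuallyEq (n := n)] with z h1 h2
    rw [h1, ← h2]
  · obtain ⟨U, hU, H⟩ := hB _ (hx.somePath_mem t)
    rw [Complex.analyticAt_iff_eventually_differentiableAt]
    filter_upwards [hU] with z hz using H z hz j

theorem segment_I_subset {y : ℂ} (hy : 0 ≤ y.im) :
    segment ℝ Complex.I y ⊆ {z | 0 < z.im ∨ z = y} := by
  rintro z ⟨a, b, ha, hb, hab, rfl⟩
  rcases ha.eq_or_lt with rfl | ha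
  · right
    rw [zero_add] at hab
    simp [hab]
  · left
    simp only [Complex.add_im, Complex.real_smul, Complex.mul_im, Complex.ofReal_re, Complex.I_im,
      Complex.ofReal_im, Complex.I_re]
    nlinarith [mul_nonneg hb hy]

/-- The path runs through `Complex.I`, so that it can meet the real axis only at its endpoints. -/
theorem joinedIn_upperHalfPlane {x : ℂ} (hx : 0 ≤ x.im) :
    JoinedIn {z : ℂ | 0 < z.im ∨ z = 1 / 2 ∨ z = x} (1 / 2) x := by
  have h1 : JoinedIn {z : ℂ | 0 < z.im ∨ z = 1 / 2 ∨ z = x} Complex.I (1 / 2) :=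
    JoinedIn.of_segment_subset ((segment_I_subset (by simp)).trans
      fun z hz => hz.imp_right Or.inl)
  have h2 : JoinedIn {z : ℂ | 0 < z.im ∨ z = 1 / 2 ∨ z = x} Complex.I x :=
    JoinedIn.of_segment_subset ((segment_I_subset hx).trans fun z hz => hz.imp_right Or.inr)
  exact h1.symm.trans h2

/-- The left side is the logarithm cut along the negative imaginary axis; it continues the principal
branch from the right half plane through the upper half plane to the negative reals. -/
theorem log_neg_I_mul {z : ℂ} (hz : 0 < z.re) :
    Complex.log (-Complex.I * z) + Real.pi / 2 * Complex.I = Complex.log z := by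
  have h0 : z ≠ 0 := by rintro rfl; simp at hz
  have ha := abs_lt.1 (Complex.abs_arg_lt_pi_div_two_iff.2 (Or.inl hz))
  rw [Complex.log_mul (neg_ne_zero.2 Complex.I_ne_zero) h0, Complex.log_neg_I]
  · ring
  · rw [Complex.arg_neg_I]
    constructor <;> linarith [ha.1, ha.2]

/-- Here the cut is the positive imaginary axis. With `1 - z` in place of `z` this branch covers `z`
in the upper half plane and `z > 1`. -/
theorem log_I_mul {z : ℂ} (hz : 0 < z.re) :
    Complex.log (Complex.I * z) - Real.pi / 2 * Complex.I = Complex.log z := by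
  have h0 : z ≠ 0 := by rintro rfl; simp at hz
  have ha := abs_lt.1 (Complex.abs_arg_lt_pi_div_two_iff.2 (Or.inl hz))
  rw [Complex.log_mul Complex.I_ne_zero h0, Complex.log_I]
  · ring
  · rw [Complex.arg_I]
    constructor <;> linarith [ha.1, ha.2]

theorem exp_log_neg_I_mul {z : ℂ} (hz : z ≠ 0) :
    Complex.exp (Complex.log (-Complex.I * z) + Real.pi / 2 * Complex.I) = z := by
  rw [Complex.exp_add, Complex.exp_log (mul_ne_zero (neg_ne_zero.2 Complex.I_ne_zero) hz),
    Complex.exp_pi_div_two_mul_I]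
  linear_combination (-z) * Complex.I_sq

theorem exp_log_I_mul {z : ℂ} (hz : z ≠ 0) :
    Complex.exp (Complex.log (Complex.I * z) - Real.pi / 2 * Complex.I) = z := by
  rw [Complex.exp_sub, Complex.exp_log (mul_ne_zero Complex.I_ne_zero hz),
    Complex.exp_pi_div_two_mul_I, mul_div_cancel_left₀ _ Complex.I_ne_zero]

theorem eventually_re_pos : ∀ᶠ z : ℂ in 𝓝 (1 / 2), 0 < z.re ∧ 0 < (1 - z).re := by
  refine Filter.Eventually.and ?_ ?_
  · exact (isOpen_lt continuous_const Complex.continuous_re).mem_nhds (by simp)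
  · exact (isOpen_lt continuous_const
      (Complex.continuous_re.comp (continuous_const.sub continuous_id))).mem_nhds (by
        simp; norm_num)

/-- Every branch at `x` has the same rational row span, so it suffices to reach one of them. The
cases are `x` off both cuts, `x` a negative real and `x` a real greater than `1`. -/
theorem branchSpan_le_polylogFib {x : ℂ} (h0 : x ≠ 0) (h1 : x ≠ 1) :
    branchSpan n x ≤ polylogFib n x := by
  by_cases hc : x ∈ cutPlane
  · by_cases hs : x ∈ Complex.slitPlane
    · rw [branchSpan, if_pos hc]
      have hstar := (Complex.starConvex_ofReal_slitPlane (x := 1 / 2) (by norm_num)).inter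
        (starConvex_cutPlane (x := 1 / 2) (by norm_num))
      have hj : JoinedIn (Complex.slitPlane ∩ cutPlane) (1 / 2) x := by
        have := JoinedIn.of_segment_subset (hstar.segment_subset ⟨hs, hc⟩)
        simpa using this
      refine ratRows_le_polylogFib hj (fun z hz => ⟨Complex.slitPlane_ne_zero hz.1,
        fun e => one_notMem_cutPlane (e ▸ hz.2)⟩)
        (B := fun z => branchZero n z (Complex.log z)) (fun y hy =>
          ⟨_, (Complex.isOpen_slitPlane.inter isOpen_cutPlane).mem_nhds hy, fun z hz j =>
          (hasDerivAt_branchZero (hasDerivAt_id z) (by simpa using Complex.hasDerivAt_log hz.1)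
            (Complex.slitPlane_ne_zero hz.1) hz.2 j).differentiableAt⟩)
        (Eventually.of_forall fun z => rfl)
    · have hx : x.re < 0 ∧ x.im = 0 := by
        simp only [Complex.mem_slitPlane_iff, not_or, not_lt, not_not] at hs
        exact ⟨lt_of_le_of_ne hs.1 fun e => h0 (Complex.ext e hs.2), hs.2⟩
      rw [branchSpan_eq_zero hc (exp_log_neg_I_mul h0)]
      have hV : ∀ z : ℂ, (0 < z.im ∨ z = 1 / 2 ∨ z = x) →
          z ∈ cutPlane ∧ -Complex.I * z ∈ Complex.slitPlane := by
        rintro z (hz | rfl | rfl)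
        · refine ⟨?_, ?_⟩
          · simp only [cutPlane, Set.mem_ofPred_eq, Complex.mem_slitPlane_iff]
            right; simp [hz.ne']
          · rw [Complex.mem_slitPlane_iff]; left; simp [hz]
        · refine ⟨one_half_mem_cutPlane, ?_⟩
          rw [Complex.mem_slitPlane_iff]; right; simp
        · refine ⟨hc, ?_⟩
          rw [Complex.mem_slitPlane_iff]; right; simp [hx.1.ne]
      have hcont : Continuous fun z : ℂ => -Complex.I * z := by fun_prop
      refine ratRows_le_polylogFib (joinedIn_upperHalfPlane hx.2.ge)
        (fun z hz => ⟨fun e => by simpa [e] using (hV z hz).2,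
          fun e => one_notMem_cutPlane (e ▸ (hV z hz).1)⟩)
        (B := fun z => branchZero n z
          (Complex.log (-Complex.I * z) + Real.pi / 2 * Complex.I)) (fun y hy =>
          ⟨_, (isOpen_cutPlane.inter (Complex.isOpen_slitPlane.preimage hcont)).mem_nhds (hV y hy),
            fun z hz j => ?_⟩) ?_
      · have hz0 : z ≠ 0 := fun e => by
          have := hz.2
          simp [e] at this
        refine (hasDerivAt_branchZero (hasDerivAt_id z) ?_ hz0 hz.1 j).differentiableAt
        convert! (((hasDerivAt_id z).const_mul (-Complex.I)).clog hz.2).add_const _ using 1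
        have := Complex.I_ne_zero
        simp only [id]
        field_simp
      · filter_upwards [eventually_re_pos] with z hz
        rw [log_neg_I_mul hz.1]
  · have hx : 1 < x.re ∧ x.im = 0 := by
      simp only [cutPlane, Set.mem_ofPred_eq, Complex.mem_slitPlane_iff, not_or, not_lt, not_not,
        Complex.sub_re, Complex.one_re, Complex.sub_im, Complex.one_im, zero_sub,
        neg_eq_zero] at hc
      exact ⟨lt_of_le_of_ne (by linarith [hc.1]) fun e => h1 (Complex.ext e.symm hc.2), hc.2⟩
    have hxs : x ∈ Complex.slitPlane := by
      rw [Complex.mem_slitPlane_iff]; left; linarith [hx.1]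
    rw [branchSpan_eq_one hxs (exp_log_I_mul (sub_ne_zero.2 h1.symm))]
    have hV : ∀ z : ℂ, (0 < z.im ∨ z = 1 / 2 ∨ z = x) →
        z ∈ Complex.slitPlane ∧ Complex.I * (1 - z) ∈ Complex.slitPlane := by
      rintro z (hz | rfl | rfl)
      · refine ⟨?_, ?_⟩
        · rw [Complex.mem_slitPlane_iff]; right; exact hz.ne'
        · rw [Complex.mem_slitPlane_iff]; left; simp [hz]
      · refine ⟨one_half_mem_slitPlane, ?_⟩
        rw [Complex.mem_slitPlane_iff]; right; simp; norm_num
      · refine ⟨hxs, ?_⟩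
        rw [Complex.mem_slitPlane_iff]; right; simp; linarith [hx.1]
    have hcont : Continuous fun z : ℂ => Complex.I * (1 - z) := by fun_prop
    have hne1 : ∀ z : ℂ, Complex.I * (1 - z) ∈ Complex.slitPlane → z ≠ 1 := by
      rintro z hz rfl
      simp at hz
    refine ratRows_le_polylogFib (joinedIn_upperHalfPlane hx.2.ge)
      (fun z hz => ⟨Complex.slitPlane_ne_zero (hV z hz).1, hne1 z (hV z hz).2⟩)
      (B := fun z => branchOne n z
        (Complex.log (Complex.I * (1 - z)) - Real.pi / 2 * Complex.I)) (fun y hy =>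
        ⟨_, (Complex.isOpen_slitPlane.inter
          (Complex.isOpen_slitPlane.preimage hcont)).mem_nhds (hV y hy), fun z hz j => ?_⟩) ?_
    · refine (hasDerivAt_branchOne (hasDerivAt_id z) ?_ hz.1 (hne1 z hz.2) j).differentiableAt
      convert! ((((hasDerivAt_id z).const_sub 1).const_mul Complex.I).clog hz.2).sub_const _ using 1
      have := Complex.I_ne_zero
      have h3 : 1 - z ≠ 0 := sub_ne_zero.2 (hne1 z hz.2).symm
      simp only [id]
      field_simp
    · filter_upwards [eventually_re_pos,
        Complex.isOpen_slitPlane.mem_nhds one_half_mem_slitPlane,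
        isOpen_cutPlane.mem_nhds one_half_mem_cutPlane] with z hz h2 h3
      rw [log_I_mul hz.2, branchZero_eq_branchOne h2 h3]

theorem polylogFib_eq_branchSpan {x : ℂ} (h0 : x ≠ 0) (h1 : x ≠ 1) :
    polylogFib n x = branchSpan n x :=
  le_antisymm (polylogFib_le_branchSpan x) (branchSpan_le_polylogFib h0 h1)

end Fibres

/-! ### Local models, and comparison with arbitrary choices -/

section Limits

variable {n : ℕ}

/-- `S` is a flat frame on the universal cover of the punctured disk `0 < |t| < 1` around `P`, where
the point with parameter `t = exp w` is `P + v t`; its rows span the rational local system, and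
`exp (-w J / 2πi) S(w)` is the function `M` of `t`. -/
structure IsLocalModel (n : ℕ) (P v : ℂ) (J : Matrix (Fin (n + 1)) (Fin (n + 1)) ℚ)
    (S M : ℂ → Matrix (Fin (n + 1)) (Fin (n + 1)) ℂ) : Prop where
  mem : P = 0 ∨ P = 1
  ne_zero : v ≠ 0
  superdiagonal : ∀ j k : Fin (n + 1), (k : ℕ) ≠ j + 1 → J j k = 0
  point_ne : ∀ w : ℂ, w.re < 0 → P + v * Complex.exp w ≠ 0 ∧ P + v * Complex.exp w ≠ 1
  flat : ∀ w : ℂ, w.re < 0 → ∀ j, HasDerivAt (fun w => S w j)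
    ((v * Complex.exp w) • (S w j ᵥ* polylogConn n (P + v * Complex.exp w))) w
  det : ∀ w, IsUnit (S w).det
  span : ∀ w : ℂ, w.re < 0 → branchSpan n (P + v * Complex.exp w) = ratRows (S w)
  eq_exp_mul : ∀ w : ℂ, S w =
    NormedSpace.exp (w • ((2 * Real.pi * Complex.I : ℂ)⁻¹ • ratMat J)) * M (Complex.exp w)
  continuousAt : ContinuousAt M 0

theorem exp_smul_add_smul (A : Matrix (Fin (n + 1)) (Fin (n + 1)) ℂ) (a b : ℂ) :
    NormedSpace.exp ((a + b) • A) = NormedSpace.exp (a • A) * NormedSpace.exp (b • A) := by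
  rw [add_smul, Matrix.exp_add_of_commute _ _ (((Commute.refl A).smul_left a).smul_right b)]

namespace IsLocalModel

variable {P v : ℂ} {J : Matrix (Fin (n + 1)) (Fin (n + 1)) ℚ}
  {S M : ℂ → Matrix (Fin (n + 1)) (Fin (n + 1)) ℂ}

theorem isNilpotent (hm : IsLocalModel n P v J S M) : IsNilpotent J :=
  isNilpotent_of_superdiagonal hm.superdiagonal

theorem unipotentLog_exp (hm : IsLocalModel n P v J S M) :
    unipotentLog (NormedSpace.exp (ratMat J)) = ratMat J :=
  _root_.unipotentLog_exp (by rw [Fintype.card_fin]; exact ratMat_pow_eq_zero hm.superdiagonal)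

/-- `M` depends only on `exp w`, so only the exponential factor changes. -/
theorem add_two_pi_I (hm : IsLocalModel n P v J S M) (w : ℂ) :
    S (w + 2 * Real.pi * Complex.I) = NormedSpace.exp (ratMat J) * S w := by
  rw [hm.eq_exp_mul, hm.eq_exp_mul w, Complex.exp_periodic w, add_comm w, exp_smul_add_smul,
    smul_smul (2 * Real.pi * Complex.I : ℂ), mul_inv_cancel₀ two_pi_I_ne_zero, one_smul,
    Matrix.mul_assoc]

end IsLocalModel

open scoped Norms.Operator in
theorem continuous_exp_smul (A : Matrix (Fin (n + 1)) (Fin (n + 1)) ℂ) :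
    Continuous fun s : ℂ => NormedSpace.exp (s • A) :=
  continuous_iff_continuousAt.2 fun s => (hasDerivAt_exp_smul_const A s).continuousAt

theorem span_range_coe_basis {ι K V : Type*} [Field K] [AddCommGroup V] [Module K V]
    {p : Submodule K V} (b : Module.Basis ι K p) :
    Submodule.span K (Set.range fun j => (b j : V)) = p := by
  have h := congrArg (Submodule.map p.subtype) b.span_eq
  rw [Submodule.map_span, ← Set.range_comp, Submodule.map_subtype_top] at h
  exact h

theorem neBot_comap_re_atBot : (comap Complex.re atBot).NeBot :=
  comap_neBot fun s hs => by
    obtain ⟨a, ha⟩ := mem_atBot_sets.1 hs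
    exact ⟨a, ha a le_rfl⟩

namespace LimitChoice

variable {P v : ℂ} (c : LimitChoice (polylogVariation n) P v)

/-- The matrix of which the rows are the multivalued flat sections. -/
def secMatrix (u : ℂ) : Matrix (Fin (n + 1)) (Fin (n + 1)) ℂ := Matrix.of fun j => c.sec j u

theorem exp_mem_closedBall {u : ℂ} (hu : u.re ≤ 0) :
    Complex.exp u ∈ Metric.closedBall (0 : ℂ) 1 := by
  rw [mem_closedBall_zero_iff, Complex.norm_exp]
  exact Real.exp_le_one_iff.2 hu

theorem chart_ne {u : ℂ} (hu : u.re ≤ 0) :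
    c.chart (Complex.exp u) ≠ 0 ∧ c.chart (Complex.exp u) ≠ 1 := by
  have := c.chart_mem _ (exp_mem_closedBall hu) (Complex.exp_ne_zero u)
  simpa [polylogVariation] using this

theorem hasDerivAt_chart_exp {u : ℂ} (hu : u.re ≤ 0) :
    HasDerivAt (fun u => c.chart (Complex.exp u))
      (deriv c.chart (Complex.exp u) * Complex.exp u) u :=
  ((c.chart_analytic _ (exp_mem_closedBall hu)).differentiableAt.hasDerivAt).comp u
    (Complex.hasDerivAt_exp u)

theorem secMatrix_flat {u : ℂ} (hu : u.re ≤ 0) (j : Fin (n + 1)) :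
    HasDerivAt (fun u => c.secMatrix u j) ((deriv c.chart (Complex.exp u) * Complex.exp u) •
      (c.secMatrix u j ᵥ* polylogConn n (c.chart (Complex.exp u)))) u :=
  c.sec_flat j u hu

theorem ratRows_secMatrix_zero :
    ratRows (c.secMatrix 0) = branchSpan n (c.chart (Complex.exp 0)) := by
  have h := c.chart_ne (u := 0) (by simp)
  rw [← polylogFib_eq_branchSpan h.1 h.2, Complex.exp_zero]
  have h1 : (fun j => c.secMatrix 0 j) = fun j => (c.basis j : Fin (n + 1) → ℂ) :=
    funext c.sec_zero
  rw [ratRows, h1]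
  exact span_range_coe_basis c.basis

/-- Rationality at the base point spreads over the half plane by connectedness. Locally the sections
are a constant matrix `A` times a rational flat frame, so rationality at a point is the condition on
`A` that its rows and those of `1` have the same rational span. -/
theorem ratRows_secMatrix {u : ℂ} (hu : u.re ≤ 0) :
    ratRows (c.secMatrix u) = branchSpan n (c.chart (Complex.exp u)) := by
  have hconv : Convex ℝ {u : ℂ | u.re ≤ 0} := convex_halfSpace_re_le 0
  have := hconv.isPreconnected.induction₂
    (fun u u' => (ratRows (c.secMatrix u) = branchSpan n (c.chart (Complex.exp u)) ↔
      ratRows (c.secMatrix u') = branchSpan n (c.chart (Complex.exp u'))))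
    (fun u hu => ?_) (fun _ _ _ _ _ _ h1 h2 => h1.trans h2) (fun _ _ _ _ h => h.symm)
    (x := 0) (y := u) (by simp) hu
  · exact this.1 c.ratRows_secMatrix_zero
  have hu' : u.re ≤ 0 := hu
  obtain ⟨r, hr, B, hB⟩ := exists_flat_frame (n := n) (c.chart_ne hu').1 (c.chart_ne hu').2
  obtain ⟨ρ, hρ, hball⟩ := Metric.eventually_nhds_iff_ball.1
    ((c.hasDerivAt_chart_exp hu').continuousAt.eventually (Metric.ball_mem_nhds _ hr))
  have hmem : ∀ u' ∈ Metric.ball u ρ ∩ {u : ℂ | u.re ≤ 0},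
      c.chart (Complex.exp u') ∈ Metric.ball (c.chart (Complex.exp u)) r :=
    fun u' h => hball u' h.1
  have huρ : u ∈ Metric.ball u ρ ∩ {u : ℂ | u.re ≤ 0} := ⟨Metric.mem_ball_self hρ, hu⟩
  obtain ⟨A, hA⟩ := flat_eq_mul ((convex_ball u ρ).inter hconv)
    (B := fun u => B (c.chart (Complex.exp u))) (Y := c.secMatrix)
    (c := fun u => deriv c.chart (Complex.exp u) * Complex.exp u)
    (z := fun u => c.chart (Complex.exp u))
    (fun u' h j => HasDerivAt.scomp (g₁ := fun y => B y j) u'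
      ((hB _ (hmem u' h)).2.2.2.2 j) (c.hasDerivAt_chart_exp h.2))
    (fun u' h j => c.secMatrix_flat h.2 j) huρ (hB _ (hmem u huρ)).2.2.1
  have key : ∀ u' ∈ Metric.ball u ρ ∩ {u : ℂ | u.re ≤ 0},
      (ratRows (c.secMatrix u') = branchSpan n (c.chart (Complex.exp u')) ↔
        ratRows A = ratRows 1) := by
    intro u' h
    have h1 := ratRows_mul_eq_iff (A := A) (A' := 1) (hB _ (hmem u' h)).2.2.1
    rw [Matrix.one_mul] at h1
    rw [hA u' h, (hB _ (hmem u' h)).2.2.2.1]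
    exact h1
  filter_upwards [self_mem_nhdsWithin,
    mem_nhdsWithin_of_mem_nhds (Metric.ball_mem_nhds u hρ)] with u' h1 h2
  rw [key u huρ, key u' ⟨h2, h1⟩]

/-- Near the origin the parameter of `IsLocalModel` is a constant multiple, up to terms of higher
order, of that of the chart. -/
theorem exists_log_chart (hv : v ≠ 0) : ∃ h : ℂ → ℂ, ContinuousAt h 0 ∧ h 0 = -c.logScale ∧
    ∃ R : ℝ, 0 ≤ R ∧ ∀ u : ℂ, u.re < -R → DifferentiableAt ℂ h (Complex.exp u) ∧
      (u + h (Complex.exp u)).re < 0 ∧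
      P + v * Complex.exp (u + h (Complex.exp u)) = c.chart (Complex.exp u) := by
  have h0 : (0 : ℂ) ∈ Metric.closedBall (0 : ℂ) 1 := by simp
  -- `g t` is `(chart t - P) / (v t)` times `λ`, continued to `t = 0`. The value `g 0 = 1` makes
  -- `log g` holomorphic near `0`.
  set g : ℂ → ℂ := fun t => dslope c.chart 0 t * (v⁻¹ * Complex.exp c.logScale)
  have hg0 : g 0 = 1 := by
    have := c.scale_eq
    simp only [g, dslope_same]
    rw [mul_comm, mul_assoc, this, inv_mul_cancel₀ hv]
  have hd : ∀ᶠ t in 𝓝 (0 : ℂ), DifferentiableAt ℂ g t := by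
    obtain ⟨U, hU, H⟩ := (c.chart_analytic 0 h0).eventually_analyticAt.exists_mem
    obtain ⟨V, hVU, hVo, h0V⟩ := mem_nhds_iff.1 hU
    have h1 : DifferentiableOn ℂ c.chart V := fun t ht =>
      (H t (hVU ht)).differentiableAt.differentiableWithinAt
    have h2 := (Complex.differentiableOn_dslope (hVo.mem_nhds h0V)).2 h1
    filter_upwards [hVo.mem_nhds h0V] with t ht
    exact (h2.differentiableAt (hVo.mem_nhds ht)).mul_const _
  have hs : ∀ᶠ t in 𝓝 (0 : ℂ), g t ∈ Complex.slitPlane :=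
    hd.self_of_nhds.continuousAt.eventually
      (Complex.isOpen_slitPlane.mem_nhds (hg0 ▸ Complex.one_mem_slitPlane))
  set h : ℂ → ℂ := fun t => Complex.log (g t) - c.logScale
  have hh : ∀ᶠ t in 𝓝 (0 : ℂ), DifferentiableAt ℂ h t := by
    filter_upwards [hd, hs] with t h1 h2 using (h1.clog h2).sub_const _
  have hcont := hh.self_of_nhds.continuousAt
  have hlt : ∀ᶠ t in 𝓝 (0 : ℂ), ‖t * Complex.exp (h t)‖ < 1 := by
    have : ContinuousAt (fun t => ‖t * Complex.exp (h t)‖) 0 :=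
      (continuousAt_id.mul hcont.cexp).norm
    refine this.eventually_lt continuousAt_const ?_
    simp
  refine ⟨h, hcont, by simp [h, hg0], ?_⟩
  obtain ⟨R, hR⟩ := eventually_atBot.1 (eventually_comap.1
    (Complex.tendsto_exp_comap_re_atBot.eventually (hh.and (hs.and hlt))))
  refine ⟨max (-R) 0, le_max_right _ _, fun u hu => ?_⟩
  obtain ⟨h1, h2, h3⟩ := hR u.re (by linarith [le_max_left (-R) 0]) u rfl
  refine ⟨h1, ?_, ?_⟩
  · rwa [← Complex.exp_add, Complex.norm_exp, Real.exp_lt_one_iff] at h3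
  · have hne := Complex.exp_ne_zero u
    have e1 : Complex.exp (h (Complex.exp u)) =
        dslope c.chart 0 (Complex.exp u) * v⁻¹ := by
      rw [Complex.exp_sub, Complex.exp_log (Complex.slitPlane_ne_zero h2),
        div_eq_iff (Complex.exp_ne_zero _), mul_assoc]
    rw [Complex.exp_add, e1, dslope_of_ne _ hne, slope_def_field, c.chart_zero]
    field_simp
    ring

/-- The rational form of the limit does not depend on the choices. -/
theorem rationalForm_eq {J : Matrix (Fin (n + 1)) (Fin (n + 1)) ℚ}
    {S M : ℂ → Matrix (Fin (n + 1)) (Fin (n + 1)) ℂ} (hm : IsLocalModel n P v J S M) :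
    c.rationalForm = ratRows (M 0) := by
  obtain ⟨h, hcont, hh0, R, hR0, hR⟩ := c.exists_log_chart hm.ne_zero
  have hopen : IsOpen {u : ℂ | u.re < -R} := isOpen_lt Complex.continuous_re continuous_const
  have hle : ∀ u : ℂ, u.re < -R → u.re ≤ 0 := fun u hu => by linarith
  set w : ℂ → ℂ := fun u => u + h (Complex.exp u)
  set J' := (2 * Real.pi * Complex.I : ℂ)⁻¹ • ratMat J
  have hw : ∀ u : ℂ, u.re < -R → HasDerivAt w (deriv w u) u := fun u hu =>
    (differentiableAt_id.add ((hR u hu).1.comp u Complex.differentiableAt_exp)).hasDerivAt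
  -- Differentiating `chart (exp u) = P + v exp (w u)` shows that the local model, pulled back along
  -- `w`, satisfies the differential equation of the chosen sections.
  have hderiv : ∀ u : ℂ, u.re < -R → deriv w u * (v * Complex.exp (w u)) =
      deriv c.chart (Complex.exp u) * Complex.exp u := by
    intro u hu
    have h1 : HasDerivAt (fun u => P + v * Complex.exp (w u))
        (deriv w u * (v * Complex.exp (w u))) u := by
      convert! ((hw u hu).cexp.const_mul v).const_add P using 1
      ring
    refine h1.unique ((c.hasDerivAt_chart_exp (hle u hu)).congr_of_eventuallyEq ?_)
    filter_upwards [hopen.mem_nhds hu] with u' hu' using (hR u' hu').2.2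
  have hflat : ∀ u : ℂ, u.re < -R → ∀ j, HasDerivAt (fun u => S (w u) j)
      ((deriv c.chart (Complex.exp u) * Complex.exp u) •
        (S (w u) j ᵥ* polylogConn n (c.chart (Complex.exp u)))) u := by
    intro u hu j
    have h1 := HasDerivAt.scomp (g₁ := fun w => S w j) u (hm.flat (w u) (hR u hu).2.1 j) (hw u hu)
    rw [smul_smul, hderiv u hu, (hR u hu).2.2] at h1
    exact h1
  obtain ⟨u₀, hu₀⟩ : ∃ u₀ : ℂ, u₀.re < -R := ⟨((-R - 1 : ℝ) : ℂ), by
    rw [Complex.ofReal_re]; linarith⟩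
  obtain ⟨A, hA⟩ := flat_eq_mul (convex_halfSpace_re_lt (-R)) (B := fun u => S (w u))
    (Y := c.secMatrix) (c := fun u => deriv c.chart (Complex.exp u) * Complex.exp u)
    (z := fun u => c.chart (Complex.exp u)) hflat
    (fun u hu j => c.secMatrix_flat (hle u hu) j) hu₀ (hm.det _)
  -- At `u₀` both frames span the same rational fibre, so the constant matrix relating them is in
  -- `GL(ℚ)`.
  obtain ⟨R₁, R₂, rfl, hR₂⟩ := exists_ratMat_of_ratRows_mul_eq (A := A) (hm.det (w u₀)) (by
    rw [← hA u₀ hu₀, c.ratRows_secMatrix (hle u₀ hu₀), ← (hR u₀ hu₀).2.2,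
      hm.span _ (hR u₀ hu₀).2.1])
  have hCA : ratMat R₂ * ratMat R₁ = 1 := by rw [← ratMat_mul, hR₂, ratMat_one]
  have hAC : ratMat R₁ * ratMat R₂ = 1 := mul_eq_one_comm.1 hCA
  have hT : ratMat c.T = ratMat R₁ * NormedSpace.exp (ratMat J) * ratMat R₂ := by
    have h1 : c.secMatrix (u₀ + 2 * Real.pi * Complex.I) = ratMat c.T * c.secMatrix u₀ := by
      ext j k
      have := congrFun (c.monodromy j u₀ (hle u₀ hu₀)) k
      refine this.trans ?_
      simp [Matrix.mul_apply, secMatrix]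
    -- The correction `h` is a function of `exp u`, so one turn in `u` is one turn in `w`.
    have hw1 : w (u₀ + 2 * Real.pi * Complex.I) = w u₀ + 2 * Real.pi * Complex.I := by
      simp only [w, Complex.exp_periodic u₀]
      ring
    rw [hA _ (by simpa using hu₀), hA u₀ hu₀, hw1, hm.add_two_pi_I, ← Matrix.mul_assoc,
      ← Matrix.mul_assoc] at h1
    have h2 := congrArg (· * (S (w u₀))⁻¹) h1
    simp only [Matrix.mul_assoc, Matrix.mul_nonsing_inv _ (hm.det (w u₀)), Matrix.mul_one] at h2
    rw [h2, Matrix.mul_assoc, hAC, Matrix.mul_one]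
  have hN : c.N = ratMat R₁ * J' * ratMat R₂ := by
    have h1 : c.N = (2 * Real.pi * Complex.I : ℂ)⁻¹ • unipotentLog (ratMat c.T) := rfl
    rw [h1, hT, unipotentLog_conj hCA, hm.unipotentLog_exp, Matrix.mul_smul,
      Matrix.smul_mul]
  have hexpN : ∀ a : ℂ, NormedSpace.exp (a • c.N) =
      ratMat R₁ * NormedSpace.exp (a • J') * ratMat R₂ := by
    intro a
    rw [hN, ← Matrix.smul_mul, ← Matrix.mul_smul, exp_conj_of_mul_eq_one hCA]
  have ht : Tendsto (fun u => NormedSpace.exp ((-u) • c.N) * c.secMatrix u)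
      (comap Complex.re atBot) (𝓝 (Matrix.of c.s₀)) := by
    refine tendsto_pi_nhds.2 fun j => ?_
    have h1 := c.s_tendsto j
    refine h1.congr fun u => ?_
    ext k
    rw [Matrix.mul_apply, Finset.sum_apply]
    rfl
  -- After conjugation by `R₁` the expression is `R₁ exp ((w - u) J') M(exp w)`, where `w - u =
  -- h(exp u)` tends to `-logScale`.
  have ht' : Tendsto (fun u => NormedSpace.exp ((-u) • c.N) * c.secMatrix u)
      (comap Complex.re atBot)
      (𝓝 (ratMat R₁ * (NormedSpace.exp ((-c.logScale) • J') * M 0))) := by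
    have hev : ∀ᶠ u : ℂ in comap Complex.re atBot, u.re < -R :=
      tendsto_comap.eventually (eventually_lt_atBot (-R))
    have hexp := Complex.tendsto_exp_comap_re_atBot
    have l1 : Tendsto (fun u => h (Complex.exp u)) (comap Complex.re atBot) (𝓝 (-c.logScale)) := by
      rw [← hh0]
      exact hcont.tendsto.comp hexp
    have l2 : Tendsto (fun u => NormedSpace.exp (h (Complex.exp u) • J'))
        (comap Complex.re atBot) (𝓝 (NormedSpace.exp ((-c.logScale) • J'))) :=
      ((continuous_exp_smul J').tendsto (-c.logScale)).comp l1
    have l3 : Tendsto (fun u => Complex.exp (w u)) (comap Complex.re atBot) (𝓝 0) := by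
      have := hexp.mul ((Complex.continuous_exp.tendsto _).comp l1)
      rw [zero_mul] at this
      refine this.congr fun u => ?_
      rw [Complex.exp_add]
      rfl
    have l4 := (l2.mul (hm.continuousAt.tendsto.comp l3)).const_mul (ratMat R₁)
    refine l4.congr' ?_
    filter_upwards [hev] with u hu
    have e : h (Complex.exp u) = -u + w u := by simp [w]
    rw [hexpN, hA u hu, hm.eq_exp_mul (w u), e, exp_smul_add_smul]
    simp only [Function.comp, Matrix.mul_assoc]
    rw [← Matrix.mul_assoc (ratMat R₂) (ratMat R₁), hCA, Matrix.one_mul]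
  have := neBot_comap_re_atBot
  have hs := tendsto_nhds_unique ht ht'
  have hform : c.rationalForm = ratRows (NormedSpace.exp (c.logScale • c.N) * Matrix.of c.s₀) := by
    rw [LimitChoice.rationalForm, ratRows]
    congr 2
    ext j k
    rw [Matrix.mul_apply, Finset.sum_apply]
    rfl
  have hone : NormedSpace.exp (c.logScale • J') * NormedSpace.exp ((-c.logScale) • J') = 1 := by
    rw [← exp_smul_add_smul, add_neg_cancel, zero_smul, NormedSpace.exp_zero]
  have hfin : NormedSpace.exp (c.logScale • c.N) * Matrix.of c.s₀ = ratMat R₁ * M 0 := by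
    rw [hs, hexpN]
    calc ratMat R₁ * NormedSpace.exp (c.logScale • J') * ratMat R₂ *
          (ratMat R₁ * (NormedSpace.exp ((-c.logScale) • J') * M 0))
        = ratMat R₁ * (NormedSpace.exp (c.logScale • J') * ((ratMat R₂ * ratMat R₁) *
          NormedSpace.exp ((-c.logScale) • J'))) * M 0 := by simp only [Matrix.mul_assoc]
      _ = ratMat R₁ * M 0 := by rw [hCA, Matrix.one_mul, hone, Matrix.mul_one]
  rw [hform, hfin, ratRows_eq_of_mul hR₂]

end LimitChoice

namespace IsLocalModel

variable {P v : ℂ} {J : Matrix (Fin (n + 1)) (Fin (n + 1)) ℚ}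
  {S M : ℂ → Matrix (Fin (n + 1)) (Fin (n + 1)) ℂ}

theorem exists_basis (hm : IsLocalModel n P v J S M) {w z : ℂ} (hw : w.re < 0)
    (hz : P + v * Complex.exp w = z) : ∃ b : Module.Basis (Fin (n + 1)) ℚ (polylogFib n z),
      ∀ j, (b j : Fin (n + 1) → ℂ) = S w j := by
  subst hz
  have hli : LinearIndependent ℚ fun j => S w j :=
    LinearIndependent.restrict_scalars' ℚ (Matrix.linearIndependent_rows_of_isUnit
      ((Matrix.isUnit_iff_isUnit_det _).2 (hm.det w)))
  have heq : Submodule.span ℚ (Set.range fun j => S w j) =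
      polylogFib n (P + v * Complex.exp w) := by
    rw [polylogFib_eq_branchSpan (hm.point_ne w hw).1 (hm.point_ne w hw).2, hm.span w hw, ratRows]
  refine ⟨(Module.Basis.span hli).map (LinearEquiv.ofEq _ _ heq), fun j => ?_⟩
  rw [Module.Basis.map_apply, LinearEquiv.coe_ofEq_apply, Module.Basis.span_apply]

/-- The local model covers only the open disk `|t| < 1`, whereas a choice needs a closed one. The
chart therefore has half the radius: `w = u - log 2` and `λ = 2`. -/
theorem nonempty_limitChoice (hm : IsLocalModel n P v J S M) :
    Nonempty (LimitChoice (polylogVariation n) P v) := by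
  have hlog : ∀ u : ℂ, Complex.exp (u - Complex.log 2) = Complex.exp u / 2 := fun u => by
    rw [Complex.exp_sub, Complex.exp_log two_ne_zero]
  have hlog2 : (Complex.log 2).re = Real.log 2 := by rw [Complex.log_re]; simp
  have hre : ∀ u : ℂ, u.re ≤ 0 → (u - Complex.log 2).re < 0 := fun u hu => by
    rw [Complex.sub_re, hlog2]
    linarith [Real.log_pos one_lt_two]
  have hpt : ∀ u : ℂ, P + v * Complex.exp (u - Complex.log 2) = P + v * (Complex.exp u / 2) :=
    fun u => by rw [hlog]
  have hchart : ∀ t : ℂ, HasDerivAt (fun t : ℂ => P + v * (t / 2)) (v / 2) t := fun t => by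
    convert! (((hasDerivAt_id t).div_const 2).const_mul v).const_add P using 1
    ring
  obtain ⟨b, hb⟩ := hm.exists_basis (z := P + v * (1 / 2)) (hre 0 (by simp))
    (by rw [hpt, Complex.exp_zero])
  set J' := (2 * Real.pi * Complex.I : ℂ)⁻¹ • ratMat J
  have hT : ratMat (IsNilpotent.exp J) = NormedSpace.exp (ratMat J) :=
    (exp_ratMat hm.isNilpotent).symm
  have hN : (2 * Real.pi * Complex.I : ℂ)⁻¹ • unipotentLog (ratMat (IsNilpotent.exp J)) = J' := by
    rw [hT, hm.unipotentLog_exp]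
  refine ⟨{
    chart := fun t => P + v * (t / 2)
    chart_analytic := fun t _ => by fun_prop
    chart_inj := fun s _ t _ h => by
      have h1 := mul_left_cancel₀ hm.ne_zero (add_left_cancel h)
      exact (div_left_inj' two_ne_zero).1 h1
    chart_zero := by simp
    chart_mem := fun t ht h0 => by
      have h1 : (Complex.log t).re ≤ 0 := by
        rw [Complex.log_re]
        exact Real.log_nonpos (norm_nonneg _) (mem_closedBall_zero_iff.1 ht)
      have h2 := hm.point_ne _ (hre _ h1)
      rw [hpt, Complex.exp_log h0] at h2
      simpa [polylogVariation] using h2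
    logScale := Complex.log 2
    scale_eq := by
      rw [(hchart 0).deriv, Complex.exp_log two_ne_zero]
      ring
    basis := b
    sec := fun j u => S (u - Complex.log 2) j
    sec_zero := fun j => (hb j).symm
    sec_flat := fun j u hu => by
      have h1 := HasDerivAt.scomp (g₁ := fun w => S w j) u (hm.flat _ (hre u hu) j)
        ((hasDerivAt_id u).sub_const (Complex.log 2))
      rw [hpt, hlog, one_smul] at h1
      rw [(hchart _).deriv]
      convert! h1 using 2
      ring
    T := IsNilpotent.exp J
    monodromy := fun j u _ => by
      rw [add_sub_right_comm, hm.add_two_pi_I, ← hT]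
      ext k
      simp [Matrix.mul_apply]
    unipotent := IsNilpotent.isNilpotent_exp_sub_one hm.isNilpotent
    s₀ := fun j => (NormedSpace.exp ((-Complex.log 2) • J') * M 0) j
    s_tendsto := fun j => ?_ }⟩
  have l1 : Tendsto (fun u : ℂ => Complex.exp (u - Complex.log 2)) (comap Complex.re atBot)
      (𝓝 0) := by
    simp_rw [hlog]
    simpa using Complex.tendsto_exp_comap_re_atBot.div_const 2
  have l2 := (hm.continuousAt.tendsto.comp l1).const_mul
    (NormedSpace.exp ((-Complex.log 2) • J'))
  refine (tendsto_pi_nhds.1 l2 j).congr fun u => ?_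
  have h1 : NormedSpace.exp ((-u) • J') * S (u - Complex.log 2) =
      NormedSpace.exp ((-Complex.log 2) • J') * M (Complex.exp (u - Complex.log 2)) := by
    rw [hm.eq_exp_mul, ← Matrix.mul_assoc, ← exp_smul_add_smul]
    congr 3
    ring
  change (NormedSpace.exp ((-Complex.log 2) • J') * M (Complex.exp (u - Complex.log 2))) j = _
  rw [← h1, hN]
  ext k
  rw [Matrix.mul_apply, Finset.sum_apply]
  rfl

end IsLocalModel

end Limits

/-! ### Hodge-Tate structures defined by triangular rational bases -/

/-! ### Mixed Hodge structures from triangular bases -/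

section Triangular

variable {n : ℕ}

theorem mem_span_stdVec {S : Set (Fin (n + 1))} {v : Fin (n + 1) → ℂ} :
    v ∈ Submodule.span ℂ (stdVec n '' S) ↔ ∀ k, k ∉ S → v k = 0 := by
  constructor
  · intro h k hk
    induction h using Submodule.span_induction with
    | mem x hx =>
      obtain ⟨j, hj, rfl⟩ := hx
      have hne : k ≠ j := fun e => hk (e ▸ hj)
      simp [stdVec, hne]
    | zero => rfl
    | add x y _ _ hx hy => rw [Pi.add_apply, hx, hy, add_zero]
    | smul a x _ hx => rw [Pi.smul_apply, hx, smul_zero]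
  · intro h
    have e : v = ∑ k, v k • stdVec n k := by
      ext i
      simp [stdVec, Finset.sum_apply, Pi.single_apply]
    rw [e]
    refine Submodule.sum_mem _ fun k _ => ?_
    by_cases hk : k ∈ S
    · exact Submodule.smul_mem _ _ (Submodule.subset_span ⟨k, hk, rfl⟩)
    · rw [h k hk, zero_smul]
      exact Submodule.zero_mem _

/-- `b j` is a non-zero multiple of `e_j` modulo the span of the `e_k` with `k > j`. -/
def IsTriangularFamily (b : Fin (n + 1) → Fin (n + 1) → ℂ) : Prop :=
  ∀ j, b j j ≠ 0 ∧ ∀ k, k < j → b j k = 0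

namespace IsTriangularFamily

variable {b : Fin (n + 1) → Fin (n + 1) → ℂ} (hb : IsTriangularFamily b)

include hb

theorem sub_mem (j : Fin (n + 1)) :
    b j - b j j • stdVec n j ∈ Submodule.span ℂ (stdVec n '' Set.Ioi j) := by
  rw [mem_span_stdVec]
  intro k hk
  rcases (not_lt.1 (show ¬ j < k from hk)).eq_or_lt with rfl | h
  · simp [stdVec]
  · simp [stdVec, (hb j).2 k h, h.ne]

/-- Downward induction on the index: `e_j` is obtained from `b j` by subtracting a combination of
later basis vectors and dividing by `b j j`. -/
theorem span_image {S : Set (Fin (n + 1))} (hS : IsUpperSet S) :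
    Submodule.span ℂ (b '' S) = Submodule.span ℂ (stdVec n '' S) := by
  apply le_antisymm
  · rw [Submodule.span_le]
    rintro _ ⟨j, hj, rfl⟩
    refine mem_span_stdVec.2 fun k hk => (hb j).2 k (not_le.1 fun h => hk (hS h hj))
  · have key : ∀ j, j ∈ S → stdVec n j ∈ Submodule.span ℂ (b '' S) := by
      intro j
      induction j using WellFoundedGT.induction with
      | ind j ih =>
        intro hj
        have h1 : Submodule.span ℂ (stdVec n '' Set.Ioi j) ≤ Submodule.span ℂ (b '' S) := by
          rw [Submodule.span_le]
          rintro _ ⟨k, hk, rfl⟩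
          exact ih k hk (hS (le_of_lt hk) hj)
        have h0 : b j ∈ Submodule.span ℂ (b '' S) := Submodule.subset_span ⟨j, hj, rfl⟩
        have h2 := Submodule.sub_mem _ h0 (h1 (hb.sub_mem j))
        rw [sub_sub_cancel] at h2
        exact (Submodule.smul_mem_iff _ (hb j).1).1 h2
    rw [Submodule.span_le]
    rintro _ ⟨j, hj, rfl⟩
    exact key j hj

theorem span_range : Submodule.span ℂ (Set.range b) = ⊤ := by
  rw [← Set.image_univ, hb.span_image isUpperSet_univ, eq_top_iff]
  exact fun v _ => mem_span_stdVec.2 fun k hk => (hk trivial).elim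

/-- A triangular family is a complex basis, so its rational span is a rational form. -/
theorem isBaseChange : IsBaseChange ℂ (Submodule.span ℚ (Set.range b)).subtype := by
  let B : Module.Basis (Fin (n + 1)) ℂ (Fin (n + 1) → ℂ) :=
    basisOfTopLeSpanOfCardEqFinrank b hb.span_range.ge (by simp)
  have hB : ⇑B = b := coe_basisOfTopLeSpanOfCardEqFinrank b hb.span_range.ge (by simp)
  have hli : LinearIndependent ℚ b :=
    LinearIndependent.restrict_scalars' ℚ (hB ▸ B.linearIndependent)
  have h1 := IsBaseChange.comp_equiv (Module.Basis.span hli).equivFun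
    (Fintype.linearCombination ℚ B) (IsBaseChange.of_fintype_basis ℚ B)
  convert h1 using 1
  ext x : 1
  have h2 := congrArg Subtype.val ((Module.Basis.span hli).sum_equivFun x)
  rw [LinearMap.comp_apply, Fintype.linearCombination_apply, hB]
  rw [Submodule.coe_sum] at h2
  simp only [Submodule.coe_smul, Module.Basis.span_apply] at h2
  exact h2.symm

end IsTriangularFamily

theorem rationalConj_smul {V : Type*} [AddCommGroup V] [Module ℂ V] [Module ℚ V]
    [IsScalarTower ℚ ℂ V] (Q : Submodule ℚ V) (h : IsBaseChange ℂ Q.subtype) {q : V} (hq : q ∈ Q)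
    (a : ℂ) : rationalConj Q h (a • q) = starRingEnd ℂ a • q := by
  have h1 : h.equiv.symm q = 1 ⊗ₜ (⟨q, hq⟩ : Q) := h.equiv_symm_apply ⟨q, hq⟩
  have h2 : rationalConj Q h q = q := by
    change h.equiv (tensorConj Q (h.equiv.symm q)) = q
    rw [h1]
    have : tensorConj Q ((1 : ℂ) ⊗ₜ[ℚ] (⟨q, hq⟩ : Q)) = (1 : ℂ) ⊗ₜ[ℚ] (⟨q, hq⟩ : Q) := by
      simp [tensorConj]
    rw [this, IsBaseChange.equiv_tmul, one_smul]
    rfl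
  rw [map_smulₛₗ, h2]

theorem rationalConj_mem_span {V : Type*} [AddCommGroup V] [Module ℂ V] [Module ℚ V]
    [IsScalarTower ℚ ℂ V] {Q : Submodule ℚ V} (h : IsBaseChange ℂ Q.subtype) {T : Set V}
    (hT : T ⊆ Q) {x : V} (hx : x ∈ Submodule.span ℂ T) :
    rationalConj Q h x ∈ Submodule.span ℂ T := by
  induction hx using Submodule.span_induction with
  | mem x hx =>
    have := rationalConj_smul Q h (hT hx) 1
    rw [one_smul, map_one, one_smul] at this
    rw [this]
    exact Submodule.subset_span hx
  | zero => rw [map_zero]; exact Submodule.zero_mem _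
  | add x y _ _ hx hy => rw [map_add]; exact Submodule.add_mem _ hx hy
  | smul a x _ hx => rw [map_smulₛₗ]; exact Submodule.smul_mem _ _ hx

theorem isUpperSet_weight (w : ℤ) : IsUpperSet {j : Fin (n + 1) | -2 * (j : ℤ) ≤ w} := by
  intro j k hjk hj
  have : (j : ℤ) ≤ k := by exact_mod_cast hjk
  simp only [Set.mem_ofPred_eq] at hj ⊢
  omega

theorem polylogF_antitone : Antitone (polylogF n) := fun p q h =>
  Submodule.span_mono (Set.image_mono fun j hj => by
    simp only [Set.mem_ofPred_eq] at hj ⊢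
    omega)

theorem polylogW_le_of_forall_ne {w : ℤ} (h : ∀ j : Fin (n + 1), w ≠ -2 * (j : ℤ)) :
    polylogW n w ≤ polylogW n (w - 1) :=
  Submodule.span_mono (Set.image_mono fun j hj => by
    have := h j
    simp only [Set.mem_ofPred_eq] at hj ⊢
    omega)

theorem stdVec_mem_inf {l : Fin (n + 1)} {p : ℤ} (hp : p ≤ -(l : ℤ)) :
    stdVec n l ∈ polylogF n p ⊓ polylogW n (-2 * (l : ℤ)) := by
  refine ⟨Submodule.subset_span ⟨l, ?_, rfl⟩, Submodule.subset_span ⟨l, le_refl (-2 * (l : ℤ)), rfl⟩⟩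
  simp only [Set.mem_ofPred_eq]
  omega

theorem polylogF_inf_polylogW {l p : ℤ} (hp : -l < p) :
    polylogF n p ⊓ polylogW n (-2 * l) = ⊥ := by
  rw [eq_bot_iff]
  rintro v ⟨h1, h2⟩
  rw [Submodule.mem_bot]
  ext k
  by_cases hk : (k : ℤ) ≤ -p
  · refine mem_span_stdVec.1 h2 k ?_
    simp only [Set.mem_ofPred_eq]
    omega
  · exact mem_span_stdVec.1 h1 k hk

theorem Ioi_span_le (l : Fin (n + 1)) :
    Submodule.span ℂ (stdVec n '' Set.Ioi l) ≤ polylogW n (-2 * (l : ℤ) - 1) :=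
  Submodule.span_mono (Set.image_mono fun j hj => by
    have : (l : ℕ) < j := hj
    simp only [Set.mem_ofPred_eq]
    omega)

theorem polylogW_le_of_mem {l : Fin (n + 1)} {K : Submodule ℂ (Fin (n + 1) → ℂ)}
    (h1 : polylogW n (-2 * (l : ℤ) - 1) ≤ K) (h2 : stdVec n l ∈ K) :
    polylogW n (-2 * (l : ℤ)) ≤ K := by
  rw [polylogW, Submodule.span_le]
  rintro _ ⟨j, hj, rfl⟩
  simp only [Set.mem_ofPred_eq] at hj
  rcases (show (l : ℕ) ≤ j by omega).eq_or_lt with e | hlt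
  · rwa [← Fin.ext e]
  · exact h1 (Submodule.subset_span ⟨j, by simp only [Set.mem_ofPred_eq]; omega, rfl⟩)

/-- The rational form spanned by a triangular family, with the weight and Hodge filtrations of the
polylogarithm variation, is a mixed Hodge structure. -/
theorem IsTriangularFamily.exists_mixedHodgeStructure {b : Fin (n + 1) → Fin (n + 1) → ℂ}
    (hb : IsTriangularFamily b) : ∃ H : MixedHodgeStructure (Fin (n + 1) → ℂ),
      H.rat = Submodule.span ℚ (Set.range b) ∧
      (∀ w, Submodule.span ℂ (H.W w : Set (Fin (n + 1) → ℂ)) = polylogW n w) ∧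
      ∀ p, H.F p = polylogF n p := by
  set Q := Submodule.span ℚ (Set.range b)
  set W : ℤ → Submodule ℚ (Fin (n + 1) → ℂ) := fun w =>
    Submodule.span ℚ (b '' {j | -2 * (j : ℤ) ≤ w})
  have hbQ : ∀ j, b j ∈ Q := fun j => Submodule.subset_span ⟨j, rfl⟩
  have hW : ∀ w, Submodule.span ℂ (W w : Set (Fin (n + 1) → ℂ)) = polylogW n w := fun w => by
    rw [Submodule.span_span_of_tower, hb.span_image (isUpperSet_weight w), polylogW]
  set σ := rationalConj Q hb.isBaseChange
  have hσb : ∀ j, σ (b j) = b j := fun j => by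
    simpa using rationalConj_smul Q hb.isBaseChange (hbQ j) 1
  have hσW : ∀ w x, x ∈ polylogW n w → σ x ∈ polylogW n w := fun w x hx => by
    rw [polylogW, ← hb.span_image (isUpperSet_weight w)] at hx ⊢
    refine rationalConj_mem_span hb.isBaseChange ?_ hx
    rintro _ ⟨j, _, rfl⟩
    exact hbQ j
  refine ⟨{
    rat := Q
    finite_rat := Module.Finite.span_of_finite ℚ (Set.finite_range b)
    isRationalForm := hb.isBaseChange
    W := W
    W_le := fun w => Submodule.span_mono (Set.image_subset_range _ _)
    W_mono := fun _ _ h => Submodule.span_mono (Set.image_mono fun _ hj => le_trans hj h)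
    W_exhaustive := ⟨0, by
      have : {j : Fin (n + 1) | -2 * (j : ℤ) ≤ 0} = Set.univ :=
        Set.eq_univ_of_forall fun j => by simp only [Set.mem_ofPred_eq]; omega
      simp only [W, this, Set.image_univ]
      rfl⟩
    W_separated := ⟨-2 * (n : ℤ) - 2, by
      have : {j : Fin (n + 1) | -2 * (j : ℤ) ≤ -2 * (n : ℤ) - 2} = ∅ :=
        Set.eq_empty_of_forall_notMem fun j => by simp only [Set.mem_ofPred_eq]; omega
      simp only [W, this, Set.image_empty, Submodule.span_empty]⟩
    F := polylogF n
    F_anti := polylogF_antitone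
    F_exhaustive := ⟨-(n : ℤ), by
      rw [eq_top_iff]
      exact fun v _ => mem_span_stdVec.2 fun k hk => by
        simp only [Set.mem_ofPred_eq] at hk
        omega⟩
    F_separated := ⟨1, by
      rw [eq_bot_iff]
      intro v hv
      rw [Submodule.mem_bot]
      ext k
      refine mem_span_stdVec.1 hv k ?_
      simp only [Set.mem_ofPred_eq]
      omega⟩
    gr_span := fun w p q hpq => ?_
    gr_disjoint := fun w p q hpq => ?_ }, rfl, hW, fun _ => rfl⟩
  · rw [hW, hW]
    -- Only the weights `-2 l` have a non-zero graded piece, namely the line of `e_l`. Since `p + q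
    -- = -2 l + 1`, exactly one of `p ≤ -l` and `q ≤ -l` holds.
    by_cases hw : ∃ l : Fin (n + 1), w = -2 * (l : ℤ)
    · obtain ⟨l, rfl⟩ := hw
      by_cases hp : p ≤ -(l : ℤ)
      · exact polylogW_le_of_mem le_sup_right
          (Submodule.mem_sup_left (Submodule.mem_sup_left (stdVec_mem_inf hp)))
      · refine polylogW_le_of_mem le_sup_right ?_
        have h1 := hb.sub_mem l
        -- Now `q ≤ -l`. Modulo lower weight `b l l • e_l` is the real vector `b l`, so its
        -- conjugate is again that multiple of `e_l`.
        have h2 : σ (b l l • stdVec n l) ∈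
            Submodule.map σ (polylogF n q ⊓ polylogW n (-2 * (l : ℤ))) :=
          ⟨_, Submodule.smul_mem _ _ (stdVec_mem_inf (by omega)), rfl⟩
        have h3 := hσW _ _ (Ioi_span_le l h1)
        have h4 := Submodule.add_mem_sup h2 h3
        rw [← map_add, add_sub_cancel, hσb] at h4
        have h5 := Submodule.sub_mem _ h4 (Submodule.mem_sup_right (Ioi_span_le l h1))
        rw [sub_sub_cancel] at h5
        exact SetLike.le_def.1 (sup_le_sup_right le_sup_right _) ((Submodule.smul_mem_iff _ (hb l).1).1 h5)
    · push Not at hw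
      exact (polylogW_le_of_forall_ne hw).trans le_sup_right
  · rw [hW, hW]
    by_cases hw : ∃ l : Fin (n + 1), w = -2 * (l : ℤ)
    · obtain ⟨l, rfl⟩ := hw
      -- One of `F^p` and `F^q` meets `W_{-2l}` in zero, so the corresponding summand contributes
      -- only lower weight.
      by_cases hp : -(l : ℤ) < p
      · rw [polylogF_inf_polylogW hp, bot_sup_eq]
        exact inf_le_left
      · rw [polylogF_inf_polylogW (p := q) (by omega), Submodule.map_bot, bot_sup_eq]
        exact inf_le_right
    · push Not at hw
      exact inf_le_left.trans (sup_le (inf_le_right.trans (polylogW_le_of_forall_ne hw)) le_rfl)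

end Triangular

/-! ### The limits of the polylogarithm variation -/

section Main

variable {n : ℕ}

theorem continuousAt_polyMat {lam : ℕ → ℂ → ℂ} {l : ℂ → ℂ} {t : ℂ}
    (h1 : ∀ k, ContinuousAt (lam (k + 1)) t) (h2 : ContinuousAt l t) :
    ContinuousAt (fun t => polyMat n (fun k => lam k t) (l t)) t := by
  refine continuousAt_pi.2 fun j => continuousAt_pi.2 fun k => ?_
  simp only [polyMat, Matrix.of_apply]
  split_ifs with h h' h''
  · exact continuousAt_const
  · exact continuousAt_const
  · obtain ⟨m, hm⟩ := Nat.exists_eq_succ_of_ne_zero h''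
    rw [hm]
    exact h1 m
  · exact continuousAt_const.mul (h2.pow _)

/-- Setting the logarithm to `0` in the frame removes the exponential factor; what remains involves
only the polylogarithms, holomorphic at `0`. -/
theorem isLocalModel_zero : IsLocalModel n 0 1 (monLogZero n)
    (fun w => branchZero n (Complex.exp w) w) (fun t => branchZero n t 0) := by
  have hc : ∀ w : ℂ, w.re < 0 → Complex.exp w ∈ cutPlane := fun w hw =>
    ball_subset_cutPlane (by
      rw [mem_ball_zero_iff, Complex.norm_exp]
      exact Real.exp_lt_one_iff.2 hw)
  refine
    { mem := Or.inl rfl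
      ne_zero := one_ne_zero
      superdiagonal := monLogZero_apply
      point_ne := fun w hw => ?_
      flat := fun w hw j => ?_
      det := fun w => isUnit_det_branchZero _ _
      span := fun w hw => ?_
      eq_exp_mul := fun w => ?_
      continuousAt := ?_ }
  · rw [one_mul, zero_add]
    exact ⟨Complex.exp_ne_zero w, fun e => one_notMem_cutPlane (e ▸ hc w hw)⟩
  · rw [one_mul, zero_add]
    refine hasDerivAt_branchZero (Complex.hasDerivAt_exp w) ?_ (Complex.exp_ne_zero w) (hc w hw) j
    rw [div_self (Complex.exp_ne_zero w)]
    exact hasDerivAt_id w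
  · rw [one_mul, zero_add]
    exact branchSpan_eq_zero (hc w hw) rfl
  · rw [← branchZero_add, zero_add]
  · exact continuousAt_polyMat (fun k => ((differentiableOn_polylog k).differentiableAt
      (isOpen_cutPlane.mem_nhds zero_mem_cutPlane)).continuousAt) continuousAt_const

/-- The tangent vector `-∂/∂z` gives `t = 1 - z`, so `w` is exactly a logarithm of `1 - z`, with no
additive constant. -/
theorem isLocalModel_one : IsLocalModel n 1 (-1) (monLogOne n)
    (fun w => branchOne n (1 - Complex.exp w) w) (fun t => branchOne n (1 - t) 0) := by
  have hc : ∀ w : ℂ, w.re < 0 → 1 - Complex.exp w ∈ Complex.slitPlane := fun w hw =>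
    ball_one_subset_slitPlane (by
      rw [Metric.mem_ball, dist_eq_norm, sub_sub_cancel_left, norm_neg, Complex.norm_exp]
      exact Real.exp_lt_one_iff.2 hw)
  have hne : ∀ w : ℂ, 1 - Complex.exp w ≠ 1 := fun w e =>
    Complex.exp_ne_zero w (by linear_combination -e)
  have hpt : ∀ w : ℂ, 1 + -1 * Complex.exp w = 1 - Complex.exp w := fun w => by ring
  have hcont : ContinuousAt (fun t : ℂ => 1 - t) 0 := by fun_prop
  have hslit : (1 - 0 : ℂ) ∈ Complex.slitPlane := by simp
  have hlog : ContinuousAt (fun t : ℂ => Complex.log (1 - t)) 0 := hcont.clog hslit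
  refine
    { mem := Or.inr rfl
      ne_zero := by simp
      superdiagonal := monLogOne_apply
      point_ne := fun w hw => ?_
      flat := fun w hw j => ?_
      det := fun w => isUnit_det_branchOne _ _
      span := fun w hw => ?_
      eq_exp_mul := fun w => ?_
      continuousAt := ?_ }
  · rw [hpt]
    exact ⟨Complex.slitPlane_ne_zero (hc w hw), hne w⟩
  · rw [hpt]
    refine hasDerivAt_branchOne (z := fun w => 1 - Complex.exp w) (l := fun w => w) ?_ ?_
      (hc w hw) (hne w) j
    · rw [neg_one_mul]
      exact (Complex.hasDerivAt_exp w).const_sub 1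
    · rw [neg_one_mul, neg_neg, sub_sub_cancel, div_self (Complex.exp_ne_zero w)]
      exact hasDerivAt_id w
  · rw [hpt]
    exact branchSpan_eq_one (hc w hw) (by ring)
  · rw [← branchOne_add, zero_add]
  · refine continuousAt_polyMat (lam := fun k t => polylogReg k (1 - t) -
      0 * (Complex.log (1 - t) ^ (k - 1) / (k - 1).factorial)) (fun k => ?_) hlog
    refine ContinuousAt.sub ?_ (continuousAt_const.mul ((hlog.pow _).div_const _))
    exact ContinuousAt.comp (g := polylogReg (k + 1)) (f := fun t : ℂ => 1 - t)
      ((differentiableOn_polylogReg k).differentiableAt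
        (Complex.isOpen_slitPlane.mem_nhds hslit)).continuousAt hcont

theorem branchZero_zero : branchZero n 0 0 = Matrix.of (limitVecZero n) := by
  ext j k
  simp only [branchZero, polyMat, limitVecZero, stdVec, Matrix.of_apply, Pi.smul_apply,
    polylog_zero_right, smul_eq_mul]
  rcases lt_trichotomy (k : ℕ) j with h | h | h
  · rw [if_pos h, Pi.single_eq_of_ne (fun e => by omega), mul_zero]
  · obtain rfl := Fin.ext h
    simp only [lt_irrefl, if_false, Pi.single_eq_same, Nat.sub_self, pow_zero, mul_one]
    split_ifs with h0
    · rw [h0, pow_zero]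
    · simp
  · rw [if_neg (by omega), Pi.single_eq_of_ne (fun e => by omega), mul_zero,
      zero_pow (by omega), mul_zero]
    split_ifs <;> first | omega | rfl

/-- The first row consists of the values of `polylogReg` at `1`; in column `1` this is `0`, which is
why the zeta values start at `k = 2`. -/
theorem branchOne_one : branchOne n 1 0 = Matrix.of (limitVecOne n) := by
  ext j k
  simp only [branchOne, polyMat, Matrix.of_apply, zero_mul, sub_zero, Complex.log_one, limitVecOne]
  by_cases hj : (j : ℕ) = 0
  · rw [if_neg (by omega), if_pos hj, if_pos hj]
    have hsum : (∑ i : Fin (n + 1), (if 2 ≤ (i : ℕ) then riemannZeta (i : ℕ) else 0) •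
        stdVec n i) k = if 2 ≤ (k : ℕ) then riemannZeta (k : ℕ) else 0 := by
      rw [Finset.sum_apply, Finset.sum_eq_single k]
      · simp [stdVec]
      · intro i _ hi
        simp [stdVec, hi.symm]
      · simp
    rw [Pi.add_apply, hsum]
    by_cases hk : (k : ℕ) = 0
    · obtain rfl : k = 0 := Fin.ext hk
      simp [stdVec]
    · rw [if_neg hk, stdVec, Pi.single_eq_of_ne (fun e => hk (by rw [e]; rfl)), zero_add]
      split_ifs with h2
      · exact polylogReg_one_right h2
      · rw [show (k : ℕ) = 1 by omega, polylogReg]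
  · have := congrFun (congrFun (branchZero_zero (n := n)) j) k
    simp only [branchZero, polyMat, Matrix.of_apply, hj, if_false, limitVecZero] at this
    simp only [hj, if_false]
    exact this

theorem exists_isLimitMHS {P v : ℂ} {J : Matrix (Fin (n + 1)) (Fin (n + 1)) ℚ}
    {S M : ℂ → Matrix (Fin (n + 1)) (Fin (n + 1)) ℂ} (hm : IsLocalModel n P v J S M)
    {b : Fin (n + 1) → Fin (n + 1) → ℂ} (hb : IsTriangularFamily b) (hM : M 0 = Matrix.of b) :
    ∃ H : MixedHodgeStructure (Fin (n + 1) → ℂ),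
      IsLimitMHS (polylogVariation n) P v H ∧
      H.rat = Submodule.span ℚ (Set.range b) ∧ HasPolylogFiltrations n H := by
  obtain ⟨H, h1, h2, h3⟩ := hb.exists_mixedHodgeStructure
  refine ⟨H, ⟨?_, hm.ne_zero, hm.nonempty_limitChoice, fun c => ?_, h2, h3⟩, h1,
    fun l => ⟨?_, ?_⟩, fun p => ?_⟩
  · simpa [polylogVariation] using hm.mem
  · rw [c.rationalForm_eq hm, hM, h1]
    rfl
  · rw [h2, polylogW]
    congr 2
    ext j
    simp only [Set.mem_ofPred_eq]
    omega
  · rw [h2, polylogW]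
    congr 2
    ext j
    simp only [Set.mem_ofPred_eq]
    omega
  · rw [h3, polylogF, neg_neg]

theorem isTriangularFamily_of_polyMat {b : Fin (n + 1) → Fin (n + 1) → ℂ} {lam : ℕ → ℂ} {l : ℂ}
    (h : polyMat n lam l = Matrix.of b) : IsTriangularFamily b := by
  have hjk : ∀ j k, polyMat n lam l j k = b j k := fun j k => congrFun (congrFun h j) k
  intro j
  refine ⟨?_, fun k hk => ?_⟩
  · rw [← hjk]
    simp only [polyMat, Matrix.of_apply, lt_irrefl, if_false]
    split_ifs <;> simp
  · rw [← hjk]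
    simp only [polyMat, Matrix.of_apply]
    exact if_pos hk

end Main

end

theorem mainTheorem3 (n : ℕ) :
    (∃ H : MixedHodgeStructure (Fin (n + 1) → ℂ),
      IsLimitMHS (polylogVariation n) 0 1 H ∧
      H.rat = Submodule.span ℚ (Set.range (limitVecZero n)) ∧
      HasPolylogFiltrations n H) ∧
    (∃ H : MixedHodgeStructure (Fin (n + 1) → ℂ),
      IsLimitMHS (polylogVariation n) 1 (-1) H ∧
      H.rat = Submodule.span ℚ (Set.range (limitVecOne n)) ∧
      HasPolylogFiltrations n H) :=
  ⟨exists_isLimitMHS isLocalModel_zero (isTriangularFamily_of_polyMat branchZero_zero)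
      branchZero_zero,
    exists_isLimitMHS isLocalModel_one (isTriangularFamily_of_polyMat branchOne_one)
      (by rw [sub_zero, branchOne_one])⟩
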